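/- A ternary $[n,k,d]$ code is a $k$-dimensional subspace $C$ of $\mathbb{F}_3^n$ whose minimum weight, that is, the smallest number of nonzero coordinates of a nonzero vector of $C$, is exactly $d$. Two ternary codes of length $n$ are equivalent if one can be obtained from the other by permuting the coordinates and changing the signs of certain coordinates, that is, by a map $(x_1,\dots,x_n)\mapsto(\varepsilon_1x_{\sigma(1)},\dots,\varepsilon_nx_{\sigma(n)})$ with $\sigma\in S_n$ and $\varepsilon_1,\dots,\varepsilon_n\in\{1,-1\}$. Proposition. There are exactly $135$ ternary $[10,5,4]$ codes up to equivalence, and there are exactly $1303$ ternary $[10,5,3]$ codes up to equivalence. -/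

import Mathlib

namespace TernaryCode

/-- `d` is the minimum weight of the ternary code `C`: the smallest number of nonzero
coordinates of a nonzero codeword of `C`. -/
def IsMinWeight {n : ℕ} (C : Submodule (ZMod 3) (Fin n → ZMod 3)) (d : ℕ) : Prop :=
  IsLeast {w : ℕ | ∃ c ∈ C, c ≠ 0 ∧ hammingNorm c = w} d

/-- A ternary `[n, k, d]` code: a `k`-dimensional subspace of `𝔽₃ⁿ` with minimum weight `d`. -/
def IsCode (n k d : ℕ) (C : Submodule (ZMod 3) (Fin n → ZMod 3)) : Prop :=
  Module.finrank (ZMod 3) C = k ∧ IsMinWeight C d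

/-- The type of all ternary `[n, k, d]` codes. -/
abbrev Code (n k d : ℕ) : Type :=
  {C : Submodule (ZMod 3) (Fin n → ZMod 3) // IsCode n k d C}

/-- The map `(x₁, …, xₙ) ↦ (ε₁ x_{σ(1)}, …, εₙ x_{σ(n)})` with signs `εᵢ = ±1`. -/
def signedPerm {n : ℕ} (σ : Equiv.Perm (Fin n)) (ε : Fin n → ℤˣ) :
    (Fin n → ZMod 3) →ₗ[ZMod 3] (Fin n → ZMod 3) where
  toFun x i := ((ε i : ℤ) : ZMod 3) * x (σ i)
  map_add' x y := by
    funext i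
    simp [mul_add]
  map_smul' a x := by
    funext i
    simp [mul_left_comm]

/-- Two ternary codes are equivalent if one is obtained from the other by permuting the
coordinates and changing the signs of certain coordinates. -/
def Equivalent {n : ℕ} (C D : Submodule (ZMod 3) (Fin n → ZMod 3)) : Prop :=
  ∃ (σ : Equiv.Perm (Fin n)) (ε : Fin n → ℤˣ), D = C.map (signedPerm σ ε)

theorem signedPerm_comp {n : ℕ} (σ τ : Equiv.Perm (Fin n)) (ε δ : Fin n → ℤˣ) :
    (signedPerm τ δ).comp (signedPerm σ ε)
      = signedPerm (σ * τ) (fun i => δ i * ε (τ i)) := by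
  refine LinearMap.ext fun x => funext fun i => ?_
  simp [signedPerm, mul_assoc]

theorem signedPerm_one {n : ℕ} :
    signedPerm (1 : Equiv.Perm (Fin n)) (fun _ => 1) = LinearMap.id := by
  refine LinearMap.ext fun x => funext fun i => ?_
  simp [signedPerm]

theorem Equivalent.refl {n : ℕ} (C : Submodule (ZMod 3) (Fin n → ZMod 3)) : Equivalent C C :=
  ⟨1, fun _ => 1, by rw [signedPerm_one, Submodule.map_id]⟩

theorem Equivalent.trans {n : ℕ} {C D E : Submodule (ZMod 3) (Fin n → ZMod 3)}
    (h : Equivalent C D) (h' : Equivalent D E) : Equivalent C E := by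
  obtain ⟨σ, ε, rfl⟩ := h
  obtain ⟨τ, δ, rfl⟩ := h'
  exact ⟨σ * τ, fun i => δ i * ε (τ i), by rw [← signedPerm_comp, Submodule.map_comp]⟩

theorem Equivalent.symm {n : ℕ} {C D : Submodule (ZMod 3) (Fin n → ZMod 3)}
    (h : Equivalent C D) : Equivalent D C := by
  obtain ⟨σ, ε, rfl⟩ := h
  refine ⟨σ⁻¹, fun i => ε (σ⁻¹ i), ?_⟩
  rw [← Submodule.map_comp, signedPerm_comp]
  simp [signedPerm_one, Submodule.map_id, Int.units_mul_self]

/-- Equivalence, as an equivalence relation on the ternary `[n, k, d]` codes. -/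
def codeSetoid (n k d : ℕ) : Setoid (Code n k d) where
  r C D := Equivalent C.1 D.1
  iseqv := ⟨fun C => Equivalent.refl C.1, Equivalent.symm, Equivalent.trans⟩

/-- The set of equivalence classes of ternary `[n, k, d]` codes. -/
abbrev CodeClass (n k d : ℕ) : Type := Quotient (codeSetoid n k d)

end TernaryCode

/-! A code of dimension 5 in `𝔽₃¹⁰` is the kernel of a `5 × 10` parity check matrix of rank 5,
unique up to `GL₅(𝔽₃)`. If the minimum weight is at least 3, the columns are nonzero and pairwise
non-proportional. Signed permutations only permute the columns and change their signs, so
equivalence classes of such codes correspond to `GL₅(𝔽₃)`-orbits on spanning sets of ten points of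
the projective space `PG(4,3)`, stored as sets of 20 vectors `±x` (`exists_smul_eq_of_equivalent`,
`equivalent_of_smul_eq`).

These orbits are classified by a mass argument (`exists_smul_eq`) applied to an explicit list of
matrices. A `GL₅(𝔽₃)`-invariant number takes distinct values on the listed sets, so their orbits are
disjoint. A bound for each stabilizer gives, by orbit-stabilizer, a lower bound for the size of each
orbit. The lower bounds add up to 126422205423228, which by direct counting is also an upper bound
for the number of all spanning ten-point sets (`card_configurations_le`). Hence no orbit is missing.
It remains to count the listed codes of minimum weight 3 and of minimum weight 4.

The invariants come from a colouring. A functional `h` has as weight the number of vectors of the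
set at which it takes the value 1. Weights colour vectors, vector colours colour functionals, and
functional colours are summed. An automorphism is determined by the images of the five standard
basis vectors, all of which lie in the set. Each image must have the same colour relative to the
basis vectors already fixed, so the product of five colour class sizes bounds the stabilizer
(`card_stabilizer_le`).

All this is evaluated with the 243 functionals packed into one natural number, 64 bits each. Bitwise
operations, multiplication and reduction modulo `2 ^ (64 * m) - 1` then act on all functionals at
once. -/

namespace TernaryCode
open scoped Pointwise

/-! ### Numbers made of 64-bit lanes -/

/-- The number whose `i`-th block of 64 bits, for `i < n`, is `f i`. -/
def lanes (f : ℕ → ℕ) (n : ℕ) : ℕ := ∑ i ∈ Finset.range n, f i * 2 ^ (64 * i)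

theorem lanes_succ (f : ℕ → ℕ) (n : ℕ) : lanes f (n + 1) = 2 ^ (64 * n) * f n + lanes f n := by
  rw [lanes, Finset.sum_range_succ, add_comm, mul_comm, lanes]

theorem lanes_congr {f g : ℕ → ℕ} {n : ℕ} (h : ∀ i < n, f i = g i) : lanes f n = lanes g n :=
  Finset.sum_congr rfl fun i hi => by rw [h i (Finset.mem_range.1 hi)]

theorem lanes_add (f g : ℕ → ℕ) (n : ℕ) :
    lanes f n + lanes g n = lanes (fun i => f i + g i) n := by
  simp [lanes, add_mul, Finset.sum_add_distrib]

theorem lanes_mul (f : ℕ → ℕ) (c n : ℕ) : lanes f n * c = lanes (fun i => f i * c) n := by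
  simp only [lanes, Finset.sum_mul]
  exact Finset.sum_congr rfl fun i _ => by ring

theorem lanes_lt {f : ℕ → ℕ} {n : ℕ} (h : ∀ i < n, f i < 2 ^ 64) : lanes f n < 2 ^ (64 * n) := by
  induction n with
  | zero => simp [lanes]
  | succ n ih =>
    have h1 := ih fun i hi => h i (by omega)
    have h2 := h n (by omega)
    rw [lanes_succ, show 64 * (n + 1) = 64 * n + 64 by ring, pow_add]
    calc _ < 2 ^ (64 * n) * f n + 2 ^ (64 * n) := by omega
      _ = 2 ^ (64 * n) * (f n + 1) := by ring
      _ ≤ _ := Nat.mul_le_mul_left _ h2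

/-- Entries below `2 ^ 64` do not overlap, so bit `k` belongs to lane `k / 64`. Every lane-wise bit
operation is deduced from this. -/
theorem testBit_lanes {f : ℕ → ℕ} {n : ℕ} (h : ∀ i < n, f i < 2 ^ 64) (k : ℕ) :
    (lanes f n).testBit k = (decide (k / 64 < n) && (f (k / 64)).testBit (k % 64)) := by
  induction n with
  | zero => simp [lanes]
  | succ n ih =>
    have h1 := fun i (hi : i < n) => h i (by omega)
    rw [lanes_succ, Nat.testBit_two_pow_mul_add _ (lanes_lt h1), ih h1]
    split_ifs with hk
    · have : k / 64 < n := by omega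
      simp [this, show k / 64 < n + 1 by omega]
    · have hk' : ¬ k / 64 < n := by omega
      by_cases hn : k / 64 = n
      · simp [hn, show k - 64 * n = k % 64 by omega]
      · have : (f n).testBit (k - 64 * n) = false :=
          Nat.testBit_lt_two_pow ((h n (by omega)).trans_le
            (Nat.pow_le_pow_right (by norm_num) (by omega)))
        simp [this, show ¬ k / 64 < n + 1 by omega]

theorem lanes_land {f g : ℕ → ℕ} {n : ℕ} (hf : ∀ i < n, f i < 2 ^ 64) (hg : ∀ i < n, g i < 2 ^ 64) :
    Nat.land (lanes f n) (lanes g n) = lanes (fun i => f i &&& g i) n := by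
  refine Nat.eq_of_testBit_eq fun k => ?_
  change (lanes f n &&& lanes g n).testBit k = _
  rw [Nat.testBit_land, testBit_lanes hf, testBit_lanes hg,
    testBit_lanes fun i hi => Nat.and_lt_two_pow _ (hg i hi), Nat.testBit_land]
  cases decide (k / 64 < n) <;> simp

/-- The number with `c` in each of `243` lanes. -/
theorem lanes_const_mul (c : ℕ) : lanes (fun _ => 1) 243 * c = lanes (fun _ => c) 243 := by
  simp [lanes_mul]

/-- A shift moves bits of the next lane into the top of each lane. The condition `s + m ≤ 64`
ensures that the mask removes them. -/
theorem lanes_shiftRight_land {f : ℕ → ℕ} {n : ℕ} (s m : ℕ) (hsm : s + m ≤ 64)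
    (hf : ∀ i < n, f i < 2 ^ 64) :
    Nat.land (Nat.shiftRight (lanes f n) s) (lanes (fun _ => 2 ^ m - 1) n)
      = lanes (fun i => f i / 2 ^ s % 2 ^ m) n := by
  have hm : 2 ^ m ≤ 2 ^ 64 := Nat.pow_le_pow_right (by norm_num) (by omega)
  have hm0 : 0 < 2 ^ m := by positivity
  refine Nat.eq_of_testBit_eq fun k => ?_
  change ((lanes f n >>> s) &&& lanes (fun _ => 2 ^ m - 1) n).testBit k = _
  rw [Nat.testBit_land, Nat.testBit_shiftRight, testBit_lanes hf,
    testBit_lanes (fun _ _ => by omega),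
    testBit_lanes fun i hi => (Nat.mod_lt _ hm0).trans_le hm,
    Nat.testBit_two_pow_sub_one, Nat.testBit_mod_two_pow, Nat.testBit_div_two_pow]
  by_cases hk : k % 64 < m
  · rw [show (s + k) / 64 = k / 64 by omega, show (s + k) % 64 = k % 64 + s by omega]
    cases decide (k / 64 < n) <;> simp [hk, add_comm]
  · simp [hk]

/-- Since `2 ^ (64 * m) ≡ 1`, reduction folds lane `i` onto lane `i % m`. As this is only a
congruence, overflow of the sums is harmless. The case `m = 1` adds all lanes; `m = 3 ^ i` groups
functionals by their first `i` coefficients. -/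
theorem lanes_mod (f : ℕ → ℕ) (n m : ℕ) :
    lanes f n % (2 ^ (64 * m) - 1)
      = (∑ i ∈ Finset.range n, f i * 2 ^ (64 * (i % m))) % (2 ^ (64 * m) - 1) := by
  refine Nat.ModEq.sum fun i _ => Nat.ModEq.mul_left _ ?_
  have h1 : 2 ^ (64 * m) ≡ 1 [MOD 2 ^ (64 * m) - 1] := by
    have : 1 ≤ 2 ^ (64 * m) := Nat.one_le_two_pow
    exact ((Nat.modEq_iff_dvd' this).2 dvd_rfl).symm
  calc 2 ^ (64 * i) = 2 ^ (64 * (i % m)) * (2 ^ (64 * m)) ^ (i / m) := by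
        rw [← pow_mul, ← pow_add]
        congr 1
        conv_lhs => rw [← Nat.mod_add_div i m]
        ring
    _ ≡ 2 ^ (64 * (i % m)) * 1 ^ (i / m) [MOD 2 ^ (64 * m) - 1] := (h1.pow _).mul_left _
    _ = _ := by simp

/-! ### Invariants of finite sets of vectors in `𝔽₃⁵` -/

/-- The space `𝔽₃⁵`. -/
abbrev V5 : Type := Fin 5 → ZMod 3

/-- The functionals on `𝔽₃⁵`. -/
abbrev D5 : Type := V5 →ₗ[ZMod 3] ZMod 3

/-- The group `GL₅(𝔽₃)`. -/
abbrev G5 : Type := V5 ≃ₗ[ZMod 3] V5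

noncomputable instance : Fintype D5 :=
  have : Finite D5 := DFunLike.finite _
  Fintype.ofFinite _

noncomputable instance : Fintype G5 :=
  have : Finite G5 := DFunLike.finite _
  Fintype.ofFinite _

/-- The modulus of horizontal sums. -/
def modulus : ℕ := 2 ^ 64 - 1

/-- Scrambling of the colour of a point. -/
def squareMod (t : ℕ) : ℕ := Nat.mod (Nat.mul t t) 4294967291

/-- Scrambling of the colour of a functional. -/
def scramble (x : ℕ) : ℕ :=
  (x % 2 ^ 32 * 1540483477) / 2 ^ 16 % 2 ^ 32 * 739982445 / 2 ^ 16 % 2 ^ 32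

/-- The number of `v ∈ S` at which `h` takes the value `1`. -/
def weight (S : Finset V5) (h : D5) : ℕ := ∑ v ∈ S, if h v = 1 then 1 else 0

/-- The colour of a vector; there is a coarse and a fine version. -/
noncomputable def pointColour (S : Finset V5) : Bool → V5 → ℕ
  | false, v => squareMod ((∑ h : D5, if h v = 1 then 5 ^ weight S h else 0) % modulus)
  | true, v => ∑ u ∈ S, squareMod
      ((∑ h : D5, if h u = 1 then if h v = 1 then 5 ^ weight S h else 0 else 0) % modulus)

/-- The colour of a functional. -/
noncomputable def colour (S : Finset V5) (r : Bool) (h : D5) : ℕ :=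
  scramble (∑ v ∈ S, if h v = 1 then pointColour S r v else 0)

/-- The invariant that separates the classes. -/
noncomputable def invariant (S : Finset V5) : ℕ := (∑ h : D5, colour S false h) % modulus

/-- The number whose base-`3` digits are the first `i` coefficients of a functional. -/
def prefixIndex (i : ℕ) (h : D5) : ℕ :=
  ∑ k : Fin 5, if (k : ℕ) < i then (h (Pi.single k 1)).val * 3 ^ (k : ℕ) else 0

/-- The colour of a vector, relative to the first `i` standard basis vectors. -/
noncomputable def relativeColour (S : Finset V5) (r : Bool) (i : ℕ) (v : V5) : ℕ :=
  (∑ h : D5, if h v = 1 then colour S r h * 2 ^ (64 * prefixIndex i h) else 0)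
    % (2 ^ (64 * 3 ^ i) - 1)

/-- The number of `v ∈ S` with the same relative colour as the standard basis vector `e`. -/
noncomputable def colourClassCard (S : Finset V5) (r : Bool) (i : ℕ) (e : V5) : ℕ :=
  ∑ v ∈ S, if relativeColour S r i v = relativeColour S r i e then 1 else 0

/-! ### Invariance under the linear group -/

theorem sum_smul_finset (g : G5) (S : Finset V5) (f : V5 → ℕ) :
    ∑ v ∈ g • S, f v = ∑ v ∈ S, f (g v) := by
  rw [← Finset.image_smul, Finset.sum_image fun _ _ _ _ h => smul_left_cancel g h]
  rfl

/-- Precomposition with `g` permutes the dual space; all invariance statements below reduce to this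
reindexing. -/
theorem sum_dual_comp (g : G5) (f : D5 → ℕ) :
    ∑ h : D5, f (h ∘ₗ (g : V5 →ₗ[ZMod 3] V5)) = ∑ h : D5, f h := by
  refine Fintype.sum_bijective (fun h : D5 => h ∘ₗ (g : V5 →ₗ[ZMod 3] V5)) ?_ _ _ fun _ => rfl
  exact (LinearEquiv.dualMap g).bijective

theorem weight_smul (g : G5) (S : Finset V5) (h : D5) :
    weight (g • S) h = weight S (h ∘ₗ (g : V5 →ₗ[ZMod 3] V5)) := by
  rw [weight, sum_smul_finset]
  rfl

/-- Colours depend only on `S` and on the incidences `h v = 1`. Invariance therefore holds whatever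
the base 5 and the scrambling functions are; these only affect how well the colours separate. -/
theorem pointColour_smul (g : G5) (S : Finset V5) (r : Bool) (v : V5) :
    pointColour (g • S) r (g v) = pointColour S r v := by
  cases r
  · simp only [pointColour]
    conv_rhs => rw [← sum_dual_comp g]
    simp [weight_smul]
  · simp only [pointColour, sum_smul_finset]
    refine Finset.sum_congr rfl fun u _ => ?_
    conv_rhs => rw [← sum_dual_comp g]
    simp [weight_smul]

theorem colour_smul (g : G5) (S : Finset V5) (r : Bool) (h : D5) :
    colour (g • S) r h = colour S r (h ∘ₗ (g : V5 →ₗ[ZMod 3] V5)) := by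
  simp [colour, sum_smul_finset, pointColour_smul]

theorem invariant_smul (g : G5) (S : Finset V5) : invariant (g • S) = invariant S := by
  simp only [invariant, colour_smul]
  rw [sum_dual_comp g fun h => colour S false h]

/-- Precomposition with `g` preserves the colour of `h` because `g` preserves `S`, and it preserves
the first `i` coefficients of `h` because `g` fixes the first `i` basis vectors. -/
theorem relativeColour_smul {g : G5} {S : Finset V5} (hS : g • S = S) (r : Bool) {i : ℕ}
    (hg : ∀ k : Fin 5, (k : ℕ) < i → g (Pi.single k 1) = Pi.single k 1) (v : V5) :
    relativeColour S r i (g v) = relativeColour S r i v := by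
  simp only [relativeColour]
  conv_rhs => rw [← sum_dual_comp g]
  refine congrArg (· % (2 ^ (64 * 3 ^ i) - 1)) (Finset.sum_congr rfl fun h _ => ?_)
  have h1 : prefixIndex i (h ∘ₗ (g : V5 →ₗ[ZMod 3] V5)) = prefixIndex i h := by
    refine Finset.sum_congr rfl fun k _ => ?_
    split_ifs with hk
    · simp [hg k hk]
    · rfl
  have h2 : colour S r (h ∘ₗ (g : V5 →ₗ[ZMod 3] V5)) = colour S r h := by
    rw [← colour_smul, hS]
  simp [h1, h2]

/-! ### A bound for the number of automorphisms -/

open Classical in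
/-- The automorphisms of `S` that fix the first `i` standard basis vectors. -/
noncomputable def partialStabilizer (S : Finset V5) (i : ℕ) : Finset G5 :=
  {g | g • S = S ∧ ∀ k : Fin 5, (k : ℕ) < i → g (Pi.single k 1) = Pi.single k 1}

theorem mem_partialStabilizer {S : Finset V5} {i : ℕ} {g : G5} :
    g ∈ partialStabilizer S i ↔
      g • S = S ∧ ∀ k : Fin 5, (k : ℕ) < i → g (Pi.single k 1) = Pi.single k 1 := by
  simp [partialStabilizer]

/-- One step of a stabilizer chain. The image of the next basis vector lies in `S` and has the same
relative colour; two automorphisms with the same image differ by one that also fixes this basis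
vector. -/
theorem card_partialStabilizer_le (S : Finset V5) (r : Bool) (i : Fin 5)
    (hi : Pi.single i 1 ∈ S) :
    (partialStabilizer S i).card ≤
      colourClassCard S r i (Pi.single i 1) * (partialStabilizer S (i + 1)).card := by
  classical
  have hc : colourClassCard S r i (Pi.single i 1) =
      (S.filter fun v => relativeColour S r i v
        = relativeColour S r i (Pi.single i 1)).card := by
    rw [Finset.card_filter]
    rfl
  rw [hc, mul_comm]
  refine Finset.card_le_mul_card_image_of_maps_to (f := fun g : G5 => g (Pi.single i 1))
    (fun g hg => ?_) _ fun w _ => ?_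
  · obtain ⟨h1, h2⟩ := mem_partialStabilizer.1 hg
    refine Finset.mem_filter.2 ⟨?_, relativeColour_smul h1 r h2 _⟩
    have : g • (Pi.single i 1 : V5) ∈ g • S := Finset.smul_mem_smul_finset hi
    rwa [h1] at this
  · rcases Finset.eq_empty_or_nonempty
      {g ∈ partialStabilizer S i | g (Pi.single i 1) = w} with h0 | ⟨g₀, hg₀⟩
    · rw [h0]
      simp
    · obtain ⟨h0, h0w⟩ := Finset.mem_filter.1 hg₀
      obtain ⟨h1, h2⟩ := mem_partialStabilizer.1 h0
      refine Finset.card_le_card_of_injOn (fun g => g₀⁻¹ * g) (fun g hg => ?_)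
        fun a _ b _ h => mul_left_cancel h
      obtain ⟨h3, h3w⟩ := Finset.mem_filter.1 hg
      obtain ⟨h4, h5⟩ := mem_partialStabilizer.1 h3
      refine mem_partialStabilizer.2 ⟨?_, fun k hk => ?_⟩
      · change (g₀⁻¹ * g) • S = S
        rw [mul_smul, h4, inv_smul_eq_iff, h1]
      · change g₀⁻¹ • (g (Pi.single k 1)) = _
        rw [inv_smul_eq_iff]
        change _ = g₀ (Pi.single k 1)
        rcases Nat.lt_succ_iff_lt_or_eq.1 hk with hk | hk
        · rw [h5 k hk, h2 k hk]
        · rw [show k = i from Fin.ext hk, h3w, h0w]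

theorem card_partialStabilizer_five (S : Finset V5) : (partialStabilizer S 5).card ≤ 1 := by
  refine Finset.card_le_one.2 fun a ha b hb => ?_
  refine LinearEquiv.toLinearMap_injective ((Pi.basisFun (ZMod 3) (Fin 5)).ext fun k => ?_)
  have h1 := (mem_partialStabilizer.1 ha).2 k k.2
  have h2 := (mem_partialStabilizer.1 hb).2 k k.2
  simp [h1, h2]

/-- The product of the sizes of five colour classes. -/
noncomputable def stabilizerBound (S : Finset V5) (r : Bool) : ℕ :=
  colourClassCard S r 0 (Pi.single 0 1) * (colourClassCard S r 1 (Pi.single 1 1) *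
    (colourClassCard S r 2 (Pi.single 2 1) * (colourClassCard S r 3 (Pi.single 3 1) *
      colourClassCard S r 4 (Pi.single 4 1))))

/-- The chain is run through all five basis vectors; an automorphism fixing all of them is the
identity. -/
theorem card_stabilizer_le (S : Finset V5) (r : Bool) (hS : ∀ i : Fin 5, Pi.single i 1 ∈ S) :
    Nat.card (MulAction.stabilizer G5 S) ≤ stabilizerBound S r := by
  have h : Nat.card (MulAction.stabilizer G5 S) = (partialStabilizer S 0).card := by
    rw [← Nat.card_eq_finsetCard]
    exact Nat.card_congr (Equiv.subtypeEquivRight fun g => by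
      simp [mem_partialStabilizer])
  rw [h]
  have h0 := card_partialStabilizer_le S r 0 (hS 0)
  have h1 := card_partialStabilizer_le S r 1 (hS 1)
  have h2 := card_partialStabilizer_le S r 2 (hS 2)
  have h3 := card_partialStabilizer_le S r 3 (hS 3)
  have h4 := card_partialStabilizer_le S r 4 (hS 4)
  have h5 := card_partialStabilizer_five S
  refine h0.trans (Nat.mul_le_mul_left _ (h1.trans (Nat.mul_le_mul_left _
    (h2.trans (Nat.mul_le_mul_left _ (h3.trans (Nat.mul_le_mul_left _ (h4.trans ?_))))))))
  exact (Nat.mul_le_mul_left _ h5).trans (by rw [mul_one]; rfl)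

/-- Orbit-stabilizer. Rounding down in the division only weakens a lower bound. -/
theorem div_stabilizerBound_le (S : Finset V5) (r : Bool) (hS : ∀ i : Fin 5, Pi.single i 1 ∈ S) :
    Nat.card G5 / stabilizerBound S r ≤ Nat.card (MulAction.orbit G5 S) := by
  have h := card_stabilizer_le S r hS
  have h1 : Nat.card (MulAction.orbit G5 S) * Nat.card (MulAction.stabilizer G5 S)
      = Nat.card G5 := by
    rw [Nat.card_congr (MulAction.orbitEquivQuotientStabilizer G5 S),
      ← Subgroup.card_eq_card_quotient_mul_card_subgroup]
  refine Nat.div_le_of_le_mul ?_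
  rw [← h1, mul_comm]
  exact Nat.mul_le_mul_right _ h

/-! ### Numbering of vectors and functionals -/

/-- The `k`-th base-`3` digit. -/
def digit (n k : ℕ) : ℕ := n / 3 ^ k % 3

/-- The vector whose coordinates are the digits of `a`. -/
def vec (a : ℕ) : V5 := fun k => (digit a k : ZMod 3)

/-- The functional whose coefficients are the digits of `n`. -/
def functional (n : ℕ) : D5 := ∑ k : Fin 5, (digit n k : ZMod 3) • LinearMap.proj k

theorem functional_apply (n : ℕ) (v : V5) :
    functional n v = ∑ k : Fin 5, (digit n k : ZMod 3) * v k := by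
  simp [functional]

theorem functional_vec (n a : ℕ) :
    functional n (vec a) = ((∑ k : Fin 5, digit a k * digit n k : ℕ) : ZMod 3) := by
  rw [functional_apply]
  push_cast
  exact Finset.sum_congr rfl fun k _ => mul_comm _ _

theorem digit_lt (n k : ℕ) : digit n k < 3 := Nat.mod_lt _ (by norm_num)

theorem functional_single (n : ℕ) (k : Fin 5) : functional n (Pi.single k 1) = digit n k := by
  rw [functional_apply, Finset.sum_eq_single k] <;> simp +contextual

theorem functional_single_val (n : ℕ) (k : Fin 5) :
    (functional n (Pi.single k 1)).val = digit n k := by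
  rw [functional_single, ZMod.val_natCast_of_lt (digit_lt n k)]

/-- The least significant digit is the first coefficient, so truncation to `i` coefficients is
reduction modulo `3 ^ i`, which is how `lanes_mod` folds the lanes. -/
theorem prefixIndex_functional (n i : ℕ) (hi : i ≤ 5) :
    prefixIndex i (functional n) = n % 3 ^ i := by
  simp only [prefixIndex, functional_single_val, digit, Fin.sum_univ_five]
  interval_cases i <;> simp [Nat.mod_one] <;> omega

theorem functional_bijective : Function.Bijective fun n : Fin 243 => functional n := by
  refine (Fintype.bijective_iff_injective_and_card _).2 ⟨fun m n h => ?_, ?_⟩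
  · have h1 := prefixIndex_functional m 5 le_rfl
    have h2 := prefixIndex_functional n 5 le_rfl
    rw [show functional m = functional n from h, h2] at h1
    refine Fin.ext ?_
    have := m.2
    have := n.2
    omega
  · have h : Fintype.card D5 = 3 ^ 5 := by
      rw [Module.card_eq_pow_finrank (K := ZMod 3), ZMod.card,
        Subspace.dual_finrank_eq (K := ZMod 3) (V := V5)]
      simp
    rw [h, Fintype.card_fin]
    norm_num

theorem sum_functional (f : D5 → ℕ) :
    ∑ n ∈ Finset.range 243, f (functional n) = ∑ h : D5, f h := by
  rw [Finset.sum_range]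
  exact Fintype.sum_bijective _ functional_bijective _ _ fun _ => rfl

/-! ### Sums along lists -/

/-- The right fold of a list, in a form that the kernel unfolds quickly. -/
noncomputable def listFold {α β : Type} (f : α → β → β) (b : β) (l : List α) : β :=
  List.rec b (fun a _ ih => f a ih) l

/-- The sum of `f` along a list. -/
def listSum (l : List V5) (f : V5 → ℕ) : ℕ := (l.map f).sum

theorem sum_toFinset {l : List V5} (hl : l.Nodup) (f : V5 → ℕ) :
    ∑ v ∈ l.toFinset, f v = listSum l f := by
  rw [listSum, List.sum_toFinset f hl]

theorem listSum_cons (v : V5) (l : List V5) (f : V5 → ℕ) :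
    listSum (v :: l) f = f v + listSum l f := by
  simp [listSum]

theorem listSum_le {l : List V5} {f : V5 → ℕ} {b : ℕ} (h : ∀ v, f v ≤ b) :
    listSum l f ≤ l.length * b := by
  induction l with
  | nil => simp [listSum]
  | cons v l ih =>
    rw [listSum_cons, List.length_cons]
    nlinarith [h v]

/-- The number of entries of a list at which a functional takes the value `1`. -/
def listWeight (l : List V5) (h : D5) : ℕ := listSum l fun v => if h v = 1 then 1 else 0

theorem listWeight_cons (v : V5) (l : List V5) (h : D5) :
    listWeight (v :: l) h = (if h v = 1 then 1 else 0) + listWeight l h :=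
  listSum_cons _ _ _

theorem listWeight_le (l : List V5) (h : D5) : listWeight l h ≤ l.length := by
  refine (listSum_le (b := 1) fun v => ?_).trans (by simp)
  split_ifs <;> simp

theorem weight_toFinset {l : List V5} (hl : l.Nodup) (h : D5) :
    weight l.toFinset h = listWeight l h := sum_toFinset hl _

/-! ### Masks -/

/-- The lanes of the functionals that take the value `1` at `v`. -/
def maskOf (v : V5) : ℕ :=
  lanes (fun n => if functional n v = 1 then modulus else 0) 243

/-- Mask lanes are either all ones or zero, so a bitwise "and" selects the functionals with value 1
at `v`. -/
theorem lanes_land_maskOf {f : ℕ → ℕ} (hf : ∀ i < 243, f i < 2 ^ 64) (v : V5) :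
    Nat.land (lanes f 243) (maskOf v)
      = lanes (fun n => if functional n v = 1 then f n else 0) 243 := by
  rw [maskOf, lanes_land hf]
  · refine lanes_congr fun i hi => ?_
    split_ifs
    · rw [modulus, Nat.and_two_pow_sub_one_eq_mod, Nat.mod_eq_of_lt (hf i hi)]
    · simp
  · intro i _
    split_ifs <;> simp [modulus]

theorem lanes_mod_modulus (f : D5 → ℕ) :
    Nat.mod (lanes (fun n => f (functional n)) 243) modulus = (∑ h : D5, f h) % modulus := by
  have := lanes_mod (fun n => f (functional n)) 243 1
  simp only [mul_one, Nat.mod_one, mul_zero, pow_zero] at this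
  rw [sum_functional] at this
  exact this

/-- `lanes`, in a form that the kernel can evaluate. -/
noncomputable def packLanes (f : ℕ → ℕ) (n : ℕ) : ℕ :=
  Nat.rec 0 (fun i s => s + f i * 2 ^ (64 * i)) n

theorem packLanes_eq (f : ℕ → ℕ) (n : ℕ) : packLanes f n = lanes f n := by
  induction n with
  | zero => rfl
  | succ n ih =>
    rw [lanes, Finset.sum_range_succ, ← lanes, ← ih]
    rfl

/-- The number with `1` in each lane. -/
noncomputable def unitLanes : ℕ := packLanes (fun _ => 1) 243

/-- The number with `c` in each lane. -/
noncomputable def constLanes (c : ℕ) : ℕ := Nat.mul unitLanes c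

theorem unitLanes_eq : unitLanes = lanes (fun _ => 1) 243 := packLanes_eq _ _

theorem constLanes_eq (c : ℕ) : constLanes c = lanes (fun _ => c) 243 := by
  rw [← lanes_const_mul, ← unitLanes_eq]
  rfl

/-- The `k`-th digits of the lane numbers, times `43`. -/
noncomputable def digitLanes (k : ℕ) : ℕ := packLanes (fun n => 43 * (n / 3 ^ k % 3)) 243

/-- The lanes of the integers whose residues are the values at the vector numbered `a`,
times `43`. -/
noncomputable def valueLanes (a : ℕ) : ℕ :=
  Nat.add (Nat.mul (digitLanes 0) (Nat.mod a 3)) (Nat.add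
    (Nat.mul (digitLanes 1) (Nat.mod (Nat.div a 3) 3)) (Nat.add
    (Nat.mul (digitLanes 2) (Nat.mod (Nat.div a 9) 3)) (Nat.add
    (Nat.mul (digitLanes 3) (Nat.mod (Nat.div a 27) 3))
    (Nat.mul (digitLanes 4) (Nat.mod (Nat.div a 81) 3)))))

theorem valueLanes_eq (a : ℕ) :
    valueLanes a = lanes (fun n => 43 * ∑ k : Fin 5, digit a k * digit n k) 243 := by
  change digitLanes 0 * (a % 3) + (digitLanes 1 * (a / 3 % 3) + (digitLanes 2 * (a / 9 % 3)
    + (digitLanes 3 * (a / 27 % 3) + digitLanes 4 * (a / 81 % 3)))) = _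
  simp only [digitLanes, packLanes_eq, lanes_mul, lanes_add]
  refine lanes_congr fun n _ => ?_
  simp only [Fin.sum_univ_five, digit, Fin.val_zero, Fin.val_one, Fin.val_two,
    show ((3 : Fin 5) : ℕ) = 3 from rfl, show ((4 : Fin 5) : ℕ) = 4 from rfl]
  norm_num
  ring

/-- Bit `s` of every lane, spread over the lane. -/
noncomputable def spreadBit (s x : ℕ) : ℕ := Nat.mul (Nat.land (Nat.shiftRight x s) unitLanes) modulus

theorem spreadBit_eq {f : ℕ → ℕ} {s : ℕ} (hs : s < 64) (hf : ∀ i < 243, f i < 2 ^ 64) :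
    spreadBit s (lanes f 243) = lanes (fun n => f n / 2 ^ s % 2 * modulus) 243 := by
  have h : Nat.land (Nat.shiftRight (lanes f 243) s) (lanes (fun _ => 1) 243)
      = lanes (fun n => f n / 2 ^ s % 2) 243 := lanes_shiftRight_land s 1 hs hf
  change Nat.land (Nat.shiftRight (lanes f 243) s) unitLanes * modulus = _
  rw [unitLanes_eq, h, lanes_mul]

/-- Because `43 / 128` is slightly more than `1 / 3`, bits 6 and 5 of `43 * t` are the first two
binary digits of the fractional part of `t / 3`: 00, 01 or 10 according to `t` modulo 3. The error
`t / 384` does no harm for `t ≤ 20`, the largest sum of five products of base-3 digits. -/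
theorem value_bits : ∀ t < 21,
    (43 * t / 2 ^ 5 % 2 = if ((t : ℕ) : ZMod 3) = 1 then 1 else 0) ∧
      (43 * t / 2 ^ 6 % 2 = if -((t : ℕ) : ZMod 3) = 1 then 1 else 0) := by
  decide

theorem value_le (a n : ℕ) : ∑ k : Fin 5, digit a k * digit n k < 21 := by
  have : ∑ k : Fin 5, digit a k * digit n k ≤ ∑ _k : Fin 5, 4 :=
    Finset.sum_le_sum fun k _ =>
      Nat.mul_le_mul (Nat.le_of_lt_succ (digit_lt a k)) (Nat.le_of_lt_succ (digit_lt n k))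
  simp at this
  omega

theorem spreadBit_five (a : ℕ) : spreadBit 5 (valueLanes a) = maskOf (vec a) := by
  rw [valueLanes_eq, spreadBit_eq (by norm_num) fun n _ => by have := value_le a n; omega]
  refine lanes_congr fun n _ => ?_
  rw [(value_bits _ (value_le a n)).1, functional_vec]
  split_ifs <;> simp

theorem spreadBit_six (a : ℕ) : spreadBit 6 (valueLanes a) = maskOf (-vec a) := by
  rw [valueLanes_eq, spreadBit_eq (by norm_num) fun n _ => by have := value_le a n; omega]
  refine lanes_congr fun n _ => ?_
  rw [(value_bits _ (value_le a n)).2, map_neg, functional_vec]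
  split_ifs <;> simp

/-- The masks of the numbered vectors and their negatives. -/
noncomputable def masks (l : List ℕ) : List ℕ :=
  listFold (fun a ms => (fun x => spreadBit 5 x :: spreadBit 6 x :: ms) (valueLanes a)) [] l

/-- The numbered vectors and their negatives. -/
def signedVectors (l : List ℕ) : List V5 := l.flatMap fun a => [vec a, -vec a]

theorem masks_eq (l : List ℕ) : masks l = (signedVectors l).map maskOf := by
  induction l with
  | nil => rfl
  | cons a l ih =>
    change spreadBit 5 (valueLanes a) :: spreadBit 6 (valueLanes a) :: masks l = _
    rw [ih, spreadBit_five, spreadBit_six]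
    rfl

theorem length_signedVectors (l : List ℕ) : (signedVectors l).length = 2 * l.length := by
  simp [signedVectors, mul_comm]

/-! ### Evaluation of the invariants -/

/-- The lanes of `5 ^ weight`. -/
noncomputable def weightPowLanes (ms : List ℕ) : ℕ :=
  listFold (fun m x => Nat.add x (Nat.mul (Nat.land x m) 4)) unitLanes ms

/-- Adding four times the masked lanes multiplies exactly the selected lanes by 5. At most 20
vectors occur and `5 ^ 20 < 2 ^ 64`, so no lane overflows. -/
theorem weightPowLanes_eq (l : List V5) (hl : l.length ≤ 20) :
    weightPowLanes (l.map maskOf) = lanes (fun n => 5 ^ listWeight l (functional n)) 243 := by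
  induction l with
  | nil => exact unitLanes_eq
  | cons v l ih =>
    have hl' : l.length ≤ 20 := (Nat.le_succ _).trans hl
    change weightPowLanes (l.map maskOf)
      + Nat.land (weightPowLanes (l.map maskOf)) (maskOf v) * 4 = _
    rw [ih hl', lanes_land_maskOf, lanes_mul, lanes_add]
    · refine lanes_congr fun n _ => ?_
      rw [listWeight_cons]
      split_ifs <;> ring
    · intro n _
      calc _ ≤ 5 ^ 20 := Nat.pow_le_pow_right (by norm_num) ((listWeight_le _ _).trans hl')
        _ < _ := by norm_num

/-- The colour of a point, from the mask of the point, the lanes `x` of `5 ^ weight` and all the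
masks. -/
noncomputable def pointColourCode (r : Bool) (x : ℕ) (ms : List ℕ) (m : ℕ) : ℕ :=
  @Bool.rec (fun _ => ℕ) (squareMod (Nat.mod (Nat.land x m) modulus))
    ((fun y => listFold (fun u s => Nat.add (squareMod (Nat.mod (Nat.land y u) modulus)) s) 0 ms)
      (Nat.land x m)) r

theorem squareMod_lt (t : ℕ) : squareMod t < 2 ^ 32 :=
  (Nat.mod_lt _ (by norm_num)).trans (by norm_num)

theorem pointColour_lt {l : List V5} (hl : l.Nodup) (hl' : l.length ≤ 20) (r : Bool) (v : V5) :
    pointColour l.toFinset r v ≤ 20 * 2 ^ 32 := by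
  cases r
  · exact (squareMod_lt _).le.trans (by norm_num)
  · simp only [pointColour]
    rw [sum_toFinset hl]
    exact (listSum_le fun u => (squareMod_lt _).le).trans (Nat.mul_le_mul_right _ hl')

theorem pointColourCode_eq {l : List V5} (hl : l.Nodup) (hl' : l.length ≤ 20) (r : Bool) (v : V5) :
    pointColourCode r (weightPowLanes (l.map maskOf)) (l.map maskOf) (maskOf v)
      = pointColour l.toFinset r v := by
  have hlt : ∀ n, 5 ^ listWeight l (functional n) < 2 ^ 64 := fun n =>
    calc _ ≤ 5 ^ 20 := Nat.pow_le_pow_right (by norm_num) ((listWeight_le _ _).trans hl')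
      _ < _ := by norm_num
  rw [weightPowLanes_eq l hl']
  cases r
  · change squareMod (Nat.mod (Nat.land _ _) modulus) = _
    rw [lanes_land_maskOf fun n _ => hlt n,
      lanes_mod_modulus fun h => if h v = 1 then 5 ^ listWeight l h else 0]
    simp only [pointColour, weight_toFinset hl]
  · change listFold (fun u s => Nat.add (squareMod (Nat.mod (Nat.land (Nat.land _ _) u) modulus)) s)
      0 (l.map maskOf) = _
    simp only [pointColour, weight_toFinset hl]
    rw [sum_toFinset hl, lanes_land_maskOf fun n _ => hlt n]
    -- The lanes depend on the whole list; they are frozen so that the induction below runs only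
    -- over the list of summands.
    generalize hx : lanes (fun n => if functional n v = 1 then 5 ^ listWeight l (functional n)
      else 0) 243 = x
    have key : ∀ u, squareMod (Nat.mod (Nat.land x (maskOf u)) modulus) = squareMod
        ((∑ h : D5, if h u = 1 then if h v = 1 then 5 ^ listWeight l h else 0 else 0)
          % modulus) := fun u => by
      rw [← hx, lanes_land_maskOf, lanes_mod_modulus fun h => if h u = 1 then
        if h v = 1 then 5 ^ listWeight l h else 0 else 0]
      intro n _
      have := hlt n
      split_ifs <;> omega
    simp only [← key]
    clear hlt key hx hl hl'
    induction l with
    | nil => rfl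
    | cons u l ih =>
      rw [listSum_cons, ← ih]
      rfl

/-- The scrambling of every lane. -/
noncomputable def scrambleLanes (x : ℕ) : ℕ :=
  Nat.land (Nat.shiftRight (Nat.mul (Nat.land (Nat.shiftRight (Nat.mul
    (Nat.land x (constLanes (2 ^ 32 - 1))) 1540483477) 16) (constLanes (2 ^ 32 - 1)))
    739982445) 16) (constLanes (2 ^ 32 - 1))

/-- Before each multiplication the lanes are cut to 32 bits, and the multipliers are below `2 ^ 31`,
so products stay within their lanes. -/
theorem scrambleLanes_eq {f : ℕ → ℕ} (hf : ∀ i < 243, f i < 2 ^ 64) :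
    scrambleLanes (lanes f 243) = lanes (fun n => scramble (f n)) 243 := by
  have h0 := lanes_shiftRight_land 0 32 (by norm_num) hf
  change Nat.land (lanes f 243) _ = _ at h0
  simp only [pow_zero, Nat.div_one] at h0
  have h1 : ∀ a c : ℕ, c < 2 ^ 31 → a % 2 ^ 32 * c < 2 ^ 64 := fun a c hc => by
    have : a % 2 ^ 32 < 2 ^ 32 := Nat.mod_lt _ (by norm_num)
    calc _ ≤ 2 ^ 32 * 2 ^ 31 := Nat.mul_le_mul this.le hc.le
      _ < _ := by norm_num
  have h2 := lanes_shiftRight_land (n := 243) (f := fun n => f n % 2 ^ 32 * 1540483477) 16 32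
    (by norm_num) fun n _ => h1 _ _ (by norm_num)
  have h3 := lanes_shiftRight_land (n := 243)
    (f := fun n => f n % 2 ^ 32 * 1540483477 / 2 ^ 16 % 2 ^ 32 * 739982445) 16 32
    (by norm_num) fun n _ => h1 _ _ (by norm_num)
  simp only [scrambleLanes, constLanes_eq]
  rw [h0, show ∀ x c, Nat.mul x c = x * c from fun _ _ => rfl,
    show ∀ x c, Nat.mul x c = x * c from fun _ _ => rfl, lanes_mul, h2, lanes_mul, h3]
  rfl

/-- The lanes of the colours of the functionals. -/
noncomputable def colourLanes (r : Bool) (ms : List ℕ) : ℕ :=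
  (fun x => scrambleLanes (listFold (fun m s =>
    Nat.add (Nat.land (constLanes (pointColourCode r x ms m)) m) s) 0 ms)) (weightPowLanes ms)

theorem colourLanes_eq {l : List V5} (hl : l.Nodup) (hl' : l.length ≤ 20) (r : Bool) :
    colourLanes r (l.map maskOf) = lanes (fun n => colour l.toFinset r (functional n)) 243 := by
  have hb := pointColour_lt hl hl' r
  -- The list being summed is separated from the list that determines the point colours, so that
  -- induction is possible.
  have key : ∀ l' : List V5, listFold (fun m s => Nat.add (Nat.land (constLanes
      (pointColourCode r (weightPowLanes (l.map maskOf)) (l.map maskOf) m)) m) s) 0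
      (l'.map maskOf) = lanes (fun n => listSum l' fun v =>
        if functional n v = 1 then pointColour l.toFinset r v else 0) 243 := fun l' => by
    induction l' with
    | nil => simp [listFold, listSum, lanes]
    | cons v l' ih =>
      change Nat.land (constLanes (pointColourCode r _ _ (maskOf v))) (maskOf v)
        + listFold _ 0 (l'.map maskOf) = _
      rw [ih, pointColourCode_eq hl hl', constLanes_eq,
        lanes_land_maskOf fun _ _ => (hb v).trans_lt (by norm_num), lanes_add]
      simp only [listSum_cons]
  change scrambleLanes (listFold _ 0 (l.map maskOf)) = _
  rw [key, scrambleLanes_eq]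
  · simp only [colour, sum_toFinset hl]
  · intro n _
    refine (listSum_le (b := 20 * 2 ^ 32) fun v => ?_).trans_lt
      ((Nat.mul_le_mul_right _ hl').trans_lt (by norm_num))
    split_ifs
    · exact hb v
    · simp

/-- The invariant, from the lanes of the colours. -/
noncomputable def invariantCode (ms : List ℕ) : ℕ := Nat.mod (colourLanes false ms) modulus

theorem invariantCode_eq {l : List V5} (hl : l.Nodup) (hl' : l.length ≤ 20) :
    invariantCode (l.map maskOf) = invariant l.toFinset := by
  rw [invariantCode, colourLanes_eq hl hl', lanes_mod_modulus (colour l.toFinset false)]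
  rfl

/-- The number of entries of `ps` with the same residue as `p`. -/
noncomputable def countResidue (q p : ℕ) (ps : List ℕ) : ℕ :=
  (fun c => listFold (fun p' s => Nat.add (@Bool.rec (fun _ => ℕ) 0 1
    (Nat.beq (Nat.mod p' q) c)) s) 0 ps) (Nat.mod p q)

theorem countResidue_cons (q p p' : ℕ) (ps : List ℕ) :
    countResidue q p (p' :: ps) = (if p' % q = p % q then 1 else 0) + countResidue q p ps := by
  change @Bool.rec (fun _ => ℕ) 0 1 (Nat.beq (p' % q) (p % q)) + countResidue q p ps = _
  split_ifs with h
  · rw [h, Nat.beq_refl]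
  · rw [Bool.eq_false_iff.2 fun h' => h (Nat.eq_of_beq_eq_true h')]

/-- The list of the numbers `x &&& m`. -/
noncomputable def restrictions (x : ℕ) (ms : List ℕ) : List ℕ :=
  listFold (fun m ps => Nat.land x m :: ps) [] ms

theorem colour_lt (S : Finset V5) (r : Bool) (h : D5) : colour S r h < 2 ^ 64 :=
  (Nat.mod_lt _ (by norm_num)).trans (by norm_num)

/-- A single masked number yields the relative colours for every `i`, by reduction with different
moduli. -/
theorem restriction_mod {l : List V5} (hl : l.Nodup) (hl' : l.length ≤ 20) (r : Bool) {i : ℕ}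
    (hi : i ≤ 5) (v : V5) :
    Nat.land (colourLanes r (l.map maskOf)) (maskOf v) % (2 ^ (64 * 3 ^ i) - 1)
      = relativeColour l.toFinset r i v := by
  rw [colourLanes_eq hl hl', lanes_land_maskOf fun n _ => colour_lt _ _ _, lanes_mod,
    relativeColour, ← sum_functional]
  refine congrArg (· % (2 ^ (64 * 3 ^ i) - 1)) (Finset.sum_congr rfl fun n _ => ?_)
  rw [prefixIndex_functional n i hi, ite_mul, zero_mul]

theorem countResidue_eq {l : List V5} (hl : l.Nodup) (hl' : l.length ≤ 20) (r : Bool) {i : ℕ}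
    (hi : i ≤ 5) (e : V5) :
    countResidue (2 ^ (64 * 3 ^ i) - 1) (Nat.land (colourLanes r (l.map maskOf)) (maskOf e))
      (restrictions (colourLanes r (l.map maskOf)) (l.map maskOf))
        = colourClassCard l.toFinset r i e := by
  rw [colourClassCard, sum_toFinset hl]
  simp only [← restriction_mod hl hl' r hi]
  generalize colourLanes r (l.map maskOf) = x
  clear hl hl'
  induction l with
  | nil => rfl
  | cons v l ih =>
    rw [listSum_cons, ← ih]
    exact countResidue_cons _ _ _ _

/-- The bound for the stabilizer, from the lanes `x` of the colours. -/
noncomputable def boundCode (x : ℕ) (ms : List ℕ) : ℕ :=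
  (fun ps => Nat.mul
    (countResidue (2 ^ (64 * 3 ^ 0) - 1) (Nat.land x (spreadBit 5 (valueLanes 1))) ps) (Nat.mul
    (countResidue (2 ^ (64 * 3 ^ 1) - 1) (Nat.land x (spreadBit 5 (valueLanes 3))) ps) (Nat.mul
    (countResidue (2 ^ (64 * 3 ^ 2) - 1) (Nat.land x (spreadBit 5 (valueLanes 9))) ps) (Nat.mul
    (countResidue (2 ^ (64 * 3 ^ 3) - 1) (Nat.land x (spreadBit 5 (valueLanes 27))) ps)
    (countResidue (2 ^ (64 * 3 ^ 4) - 1) (Nat.land x (spreadBit 5 (valueLanes 81))) ps)))))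
    (restrictions x ms)

theorem vec_pow_three (k : Fin 5) : vec (3 ^ (k : ℕ)) = Pi.single k 1 := by
  revert k
  decide

theorem boundCode_eq {l : List V5} (hl : l.Nodup) (hl' : l.length ≤ 20) (r : Bool) :
    boundCode (colourLanes r (l.map maskOf)) (l.map maskOf) = stabilizerBound l.toFinset r := by
  simp only [boundCode, spreadBit_five]
  rw [show vec 1 = Pi.single 0 1 from vec_pow_three 0, show vec 3 = Pi.single 1 1 from
    vec_pow_three 1, show vec 9 = Pi.single 2 1 from vec_pow_three 2, show vec 27 = Pi.single 3 1
    from vec_pow_three 3, show vec 81 = Pi.single 4 1 from vec_pow_three 4,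
    countResidue_eq hl hl' r (by norm_num), countResidue_eq hl hl' r (by norm_num),
    countResidue_eq hl hl' r (by norm_num), countResidue_eq hl hl' r (by norm_num),
    countResidue_eq hl hl' r (by norm_num)]
  rfl

/-! ### Counting words by weight -/

/-- The lanes of the weights. -/
noncomputable def weightLanes (ms : List ℕ) : ℕ :=
  listFold (fun m s => Nat.add (Nat.land unitLanes m) s) 0 ms

theorem weightLanes_eq (l : List V5) :
    weightLanes (l.map maskOf) = lanes (fun n => listWeight l (functional n)) 243 := by
  induction l with
  | nil => simp [weightLanes, listFold, listWeight, listSum, lanes]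
  | cons v l ih =>
    change Nat.land unitLanes (maskOf v) + weightLanes (l.map maskOf) = _
    rw [ih, unitLanes_eq, lanes_land_maskOf fun _ _ => by norm_num, lanes_add]
    simp only [listWeight_cons]

/-- The number of functionals of weight at least `t`, from the lanes `w` of the weights. -/
noncomputable def countHeavy (t w : ℕ) : ℕ :=
  Nat.mod (Nat.land (Nat.shiftRight (Nat.add w (constLanes (Nat.sub 32 t))) 5) unitLanes) modulus

/-- Adding `32 - t` sets bit 5 exactly when the weight is at least `t`, because weights and `t` are
at most 20. The count is at most 243, so the final reduction does not change it. -/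
theorem countHeavy_eq {l : List V5} (hl : l.length ≤ 20) {t : ℕ} (ht : t ≤ 20) :
    countHeavy t (weightLanes (l.map maskOf))
      = (Finset.univ.filter fun h : D5 => t ≤ listWeight l h).card := by
  have hw := fun h => (listWeight_le l h).trans hl
  have h := lanes_shiftRight_land (n := 243)
    (f := fun n => listWeight l (functional n) + (32 - t)) 5 1 (by norm_num)
    fun n _ => by have := hw (functional n); omega
  rw [countHeavy, weightLanes_eq, constLanes_eq, unitLanes_eq, show ∀ x y, Nat.add x y = x + y
    from fun _ _ => rfl, lanes_add]
  have h2 : (fun n => (listWeight l (functional n) + (32 - t)) / 2 ^ 5 % 2 ^ 1)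
      = fun n => if t ≤ listWeight l (functional n) then 1 else 0 := by
    funext n
    have := hw (functional n)
    split_ifs <;> omega
  rw [h2] at h
  refine (congrArg (Nat.mod · modulus) h).trans ?_
  rw [lanes_mod_modulus fun h => if t ≤ listWeight l h then 1 else 0, ← Finset.card_filter,
    Nat.mod_eq_of_lt]
  refine (Finset.card_le_univ _).trans_lt ?_
  rw [← Fintype.card_of_bijective functional_bijective]
  simp [modulus]

/-! ### Counting configurations of points -/

/-- The entries of `x` are nonzero and pairwise non-proportional. -/
def IsProjective {k : ℕ} (x : Fin k → V5) : Prop :=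
  (∀ i, x i ≠ 0) ∧ ∀ i j, i ≠ j → x i ≠ x j ∧ x i ≠ -x j

/-- The entries of `x` and their negatives. -/
def signedRange {k : ℕ} (x : Fin k → V5) : Finset V5 :=
  Finset.univ.image x ∪ Finset.univ.image fun i => -x i

theorem mem_signedRange {k : ℕ} {x : Fin k → V5} {v : V5} :
    v ∈ signedRange x ↔ ∃ i, v = x i ∨ v = -x i := by
  simp only [signedRange, Finset.mem_union, Finset.mem_image, Finset.mem_univ, true_and]
  constructor
  · rintro (⟨i, rfl⟩ | ⟨i, rfl⟩)
    exacts [⟨i, .inl rfl⟩, ⟨i, .inr rfl⟩]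
  · rintro ⟨i, rfl | rfl⟩
    exacts [.inl ⟨i, rfl⟩, .inr ⟨i, rfl⟩]

theorem neg_mem_signedRange {k : ℕ} {x : Fin k → V5} {v : V5} (hv : v ∈ signedRange x) :
    -v ∈ signedRange x := by
  obtain ⟨i, rfl | rfl⟩ := mem_signedRange.1 hv
  · exact mem_signedRange.2 ⟨i, .inr rfl⟩
  · exact mem_signedRange.2 ⟨i, .inl (neg_neg _)⟩

theorem ne_neg_self {v : V5} (hv : v ≠ 0) : v ≠ -v := by
  intro h
  refine hv (funext fun i => ?_)
  have h1 : v i = -v i := congrFun h i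
  have h2 : ∀ a : ZMod 3, a = -a → a = 0 := by decide
  exact h2 _ h1

theorem zero_notMem_signedRange {k : ℕ} {x : Fin k → V5} (hx : IsProjective x) :
    0 ∉ signedRange x := by
  intro h
  obtain ⟨i, h | h⟩ := mem_signedRange.1 h
  · exact hx.1 i h.symm
  · exact hx.1 i (neg_eq_zero.1 h.symm)

theorem card_signedRange {k : ℕ} {x : Fin k → V5} (hx : IsProjective x) :
    (signedRange x).card = 2 * k := by
  have hinj : Function.Injective x := fun i j h => by
    by_contra hij
    exact (hx.2 i j hij).1 h
  rw [signedRange, Finset.card_union_of_disjoint, Finset.card_image_of_injective _ hinj,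
    Finset.card_image_of_injective (f := fun i => -x i) _ (neg_injective.comp hinj), Finset.card_fin, two_mul]
  rw [Finset.disjoint_left]
  intro v hv hv'
  obtain ⟨i, -, rfl⟩ := Finset.mem_image.1 hv
  obtain ⟨j, -, h⟩ := Finset.mem_image.1 hv'
  rcases eq_or_ne i j with rfl | hij
  · exact ne_neg_self (hx.1 i) h.symm
  · exact (hx.2 i j hij).2 h.symm

theorem isProjective_cons {k : ℕ} {v : V5} {x : Fin k → V5} :
    IsProjective (Fin.cons v x : Fin (k + 1) → V5) ↔
      IsProjective x ∧ v ∉ insert 0 (signedRange x) := by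
  simp only [IsProjective, Finset.mem_insert, mem_signedRange, Fin.forall_fin_succ, Fin.cons_zero,
    Fin.cons_succ, ne_eq, Fin.succ_inj, not_or, not_exists]
  constructor
  · rintro ⟨⟨h1, h2⟩, ⟨-, h3⟩, h4⟩
    exact ⟨⟨h2, fun i => (h4 i).2⟩, h1, fun i => h3 i (Fin.succ_ne_zero i).symm⟩
  · rintro ⟨⟨h2, h4⟩, h1, h3⟩
    refine ⟨⟨h1, h2⟩, ⟨fun h => absurd trivial h, fun i _ => h3 i⟩, fun i => ⟨fun _ => ?_, h4 i⟩⟩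
    exact ⟨fun h => (h3 i).1 h.symm, fun h => (h3 i).2 (by rw [h, neg_neg])⟩

theorem card_filter_cons {k : ℕ} (P : (Fin (k + 1) → V5) → Prop) [DecidablePred P] :
    (Finset.univ.filter P).card =
      ∑ x : Fin k → V5, (Finset.univ.filter fun v : V5 => P (Fin.cons v x)).card := by
  simp only [Finset.card_filter]
  rw [← (Fin.consEquiv fun _ => V5).sum_comp, Fintype.sum_prod_type_right]
  rfl

/-- The span of the entries of `x`. -/
abbrev rangeSpan {k : ℕ} (x : Fin k → V5) : Submodule (ZMod 3) V5 :=
  Submodule.span (ZMod 3) (Set.range x)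

theorem signedRange_subset_rangeSpan {k : ℕ} (x : Fin k → V5) :
    ∀ v ∈ signedRange x, v ∈ rangeSpan x := by
  intro v hv
  obtain ⟨i, rfl | rfl⟩ := mem_signedRange.1 hv
  · exact Submodule.subset_span ⟨i, rfl⟩
  · exact Submodule.neg_mem _ (Submodule.subset_span ⟨i, rfl⟩)

theorem span_signedRange {k : ℕ} (x : Fin k → V5) :
    Submodule.span (ZMod 3) (signedRange x : Set V5) = rangeSpan x := by
  refine le_antisymm (Submodule.span_le.2 fun v hv => signedRange_subset_rangeSpan x v hv)
    (Submodule.span_mono ?_)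
  rintro _ ⟨i, rfl⟩
  exact mem_signedRange.2 ⟨i, .inl rfl⟩

/-- The number of projective `k`-tuples that span a space of dimension `r`. -/
def tupleCount : ℕ → ℕ → ℕ
  | 0, 0 => 1
  | 0, _ + 1 => 0
  | _ + 1, 0 => 0
  | k + 1, r + 1 => tupleCount k (r + 1) * (3 ^ (r + 1) - (2 * k + 1))
      + tupleCount k r * (3 ^ 5 - 3 ^ r)

open Classical in
theorem card_submodule_filter (W : Submodule (ZMod 3) V5) :
    (Finset.univ.filter fun v : V5 => v ∈ W).card = 3 ^ Module.finrank (ZMod 3) W := by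
  have h := Module.card_eq_pow_finrank (K := ZMod 3) (V := W)
  rw [ZMod.card] at h
  rw [← h, Fintype.card_subtype]

open Classical in
-- A new vector inside the span keeps the rank and must avoid zero and the `2 * k` vectors already
-- used. One outside the span raises the rank by 1 and is otherwise free.
theorem card_cons_le {k : ℕ} {x : Fin k → V5} (hx : IsProjective x) (r : ℕ) :
    (Finset.univ.filter fun v : V5 => v ∉ insert 0 (signedRange x) ∧
      Module.finrank (ZMod 3) (rangeSpan (Fin.cons v x : Fin (k + 1) → V5)) = r).card ≤
    (if Module.finrank (ZMod 3) (rangeSpan x) = r then 3 ^ r - (2 * k + 1) else 0) +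
      (if Module.finrank (ZMod 3) (rangeSpan x) + 1 = r then
        3 ^ 5 - 3 ^ Module.finrank (ZMod 3) (rangeSpan x) else 0) := by
  have hspan : ∀ v, rangeSpan (Fin.cons v x : Fin (k + 1) → V5) =
      Submodule.span (ZMod 3) {v} ⊔ rangeSpan x := fun v => by
    rw [rangeSpan, Fin.range_cons, Submodule.span_insert]
  have hin : ∀ v ∈ rangeSpan x, rangeSpan (Fin.cons v x : Fin (k + 1) → V5) = rangeSpan x :=
    fun v hv => by
      rw [hspan, sup_eq_right, Submodule.span_le]
      simpa using hv
  have hout : ∀ v ∉ rangeSpan x,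
      Module.finrank (ZMod 3) (rangeSpan (Fin.cons v x : Fin (k + 1) → V5)) =
        Module.finrank (ZMod 3) (rangeSpan x) + 1 := fun v hv => by
    refine le_antisymm ?_ (Submodule.finrank_lt_finrank_of_lt ?_)
    · rw [hspan, add_comm]
      refine (Submodule.finrank_add_le_finrank_add_finrank _ _).trans
        (Nat.add_le_add_right ?_ _)
      exact (finrank_span_le_card ({v} : Set V5)).trans (by simp)
    · rw [hspan]
      refine lt_of_le_of_ne le_sup_right fun h => hv ?_
      rw [h]
      exact Submodule.mem_sup_left (Submodule.mem_span_singleton_self v)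
  rw [← Finset.card_filter_add_card_filter_not (p := fun v => v ∈ rangeSpan x)]
  refine add_le_add ?_ ?_
  · split_ifs with h
    · have h1 : insert 0 (signedRange x) ⊆ Finset.univ.filter fun v => v ∈ rangeSpan x := by
        intro v hv
        refine Finset.mem_filter.2 ⟨Finset.mem_univ _, ?_⟩
        rcases Finset.mem_insert.1 hv with rfl | hv
        · exact Submodule.zero_mem _
        · exact signedRange_subset_rangeSpan x v hv
      have h2 := Finset.card_sdiff_of_subset h1
      rw [card_submodule_filter, h, Finset.card_insert_of_notMem (zero_notMem_signedRange hx),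
        card_signedRange hx] at h2
      rw [← h2]
      refine Finset.card_le_card fun v hv => ?_
      simp only [Finset.mem_filter, Finset.mem_univ, true_and] at hv
      exact Finset.mem_sdiff.2 ⟨Finset.mem_filter.2 ⟨Finset.mem_univ _, hv.2⟩, hv.1.1⟩
    · refine (Finset.card_eq_zero.2 (Finset.filter_eq_empty_iff.2 fun v hv hv' => h ?_)).le
      rw [← hin v hv']
      exact (Finset.mem_filter.1 hv).2.2
  · split_ifs with h
    · have h2 := Finset.card_compl (Finset.univ.filter fun v => v ∈ rangeSpan x)
      rw [card_submodule_filter] at h2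
      have h3 : Fintype.card V5 = 3 ^ 5 := by simp [ZMod.card]
      rw [← h3, ← h2]
      refine Finset.card_le_card fun v hv => ?_
      have := (Finset.mem_filter.1 hv).2
      simpa using this
    · refine (Finset.card_eq_zero.2 (Finset.filter_eq_empty_iff.2 fun v hv hv' => h ?_)).le
      rw [← hout v hv']
      exact (Finset.mem_filter.1 hv).2.2

open Classical in
-- Induction on the length by `card_cons_le`, summed over the tails. An upper bound suffices, since
-- the orbits supply the opposite inequality.
theorem card_tuples_le (k r : ℕ) : (Finset.univ.filter fun x : Fin k → V5 =>
    IsProjective x ∧ Module.finrank (ZMod 3) (rangeSpan x) = r).card ≤ tupleCount k r := by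
  induction k generalizing r with
  | zero =>
    cases r with
    | zero => exact (Finset.card_le_univ _).trans (by simp [tupleCount])
    | succ r =>
      refine (Finset.card_eq_zero.2 (Finset.filter_eq_empty_iff.2 fun x _ hx => ?_)).le
      have := hx.2
      rw [rangeSpan, Set.range_eq_empty, Submodule.span_empty, finrank_bot] at this
      omega
  | succ k ih =>
    rw [card_filter_cons]
    have h1 : ∀ x : Fin k → V5, (Finset.univ.filter fun v : V5 =>
        IsProjective (Fin.cons v x : Fin (k + 1) → V5) ∧
          Module.finrank (ZMod 3) (rangeSpan (Fin.cons v x : Fin (k + 1) → V5)) = r).card ≤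
        (if IsProjective x ∧ Module.finrank (ZMod 3) (rangeSpan x) = r then
          3 ^ r - (2 * k + 1) else 0) +
        (if IsProjective x ∧ Module.finrank (ZMod 3) (rangeSpan x) + 1 = r then
          3 ^ 5 - 3 ^ (r - 1) else 0) := fun x => by
      by_cases hx : IsProjective x
      · simp only [isProjective_cons, hx, true_and]
        refine (card_cons_le hx r).trans (add_le_add le_rfl (le_of_eq ?_))
        split_ifs with h
        · rw [← h, Nat.add_sub_cancel]
        · rfl
      · simp [isProjective_cons, hx]
    refine (Finset.sum_le_sum fun x _ => h1 x).trans ?_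
    rw [Finset.sum_add_distrib, ← Finset.sum_filter, ← Finset.sum_filter, Finset.sum_const,
      Finset.sum_const, smul_eq_mul, smul_eq_mul]
    cases r with
    | zero => simp [tupleCount]
    | succ r =>
      refine add_le_add (Nat.mul_le_mul_right _ (ih _)) (Nat.mul_le_mul_right _ ?_)
      simpa using ih r

open Classical in
/-- The sets of ten points of the projective space, given by the `20` vectors `±x`, that span. -/
noncomputable def configurations : Finset (Finset V5) :=
  {S | 0 ∉ S ∧ (∀ v ∈ S, -v ∈ S) ∧ S.card = 20 ∧ Submodule.span (ZMod 3) (S : Set V5) = ⊤}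

theorem mem_configurations {S : Finset V5} : S ∈ configurations ↔
    0 ∉ S ∧ (∀ v ∈ S, -v ∈ S) ∧ S.card = 20 ∧ Submodule.span (ZMod 3) (S : Set V5) = ⊤ := by
  simp [configurations]

theorem signedRange_subset {k : ℕ} {x : Fin k → V5} {S : Finset V5} (hS : ∀ v ∈ S, -v ∈ S)
    (hx : ∀ i, x i ∈ S) : signedRange x ⊆ S := by
  intro v hv
  obtain ⟨i, rfl | rfl⟩ := mem_signedRange.1 hv
  exacts [hx i, hS _ (hx i)]

open Classical in
-- The entries are chosen one after another; each choice removes a vector and its negative from `S`.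
theorem card_tuples_in (S : Finset V5) (h0 : 0 ∉ S) (hS : ∀ v ∈ S, -v ∈ S) (k : ℕ) :
    (Finset.univ.filter fun x : Fin k → V5 => IsProjective x ∧ ∀ i, x i ∈ S).card
      = ∏ i ∈ Finset.range k, (S.card - 2 * i) := by
  induction k with
  | zero => simp [IsProjective]
  | succ k ih =>
    rw [card_filter_cons, Finset.prod_range_succ, ← ih, ← smul_eq_mul, ← Finset.sum_const,
      Finset.sum_filter]
    refine Finset.sum_congr rfl fun x _ => ?_
    simp only [isProjective_cons, Fin.forall_fin_succ, Fin.cons_zero, Fin.cons_succ]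
    split_ifs with h
    · rw [← card_signedRange h.1, ← Finset.card_sdiff_of_subset (signedRange_subset hS h.2)]
      congr 1
      ext v
      simp only [h.1, h.2, Finset.mem_filter, Finset.mem_univ, true_and, Finset.mem_insert,
        Finset.mem_sdiff, not_or]
      constructor
      · rintro ⟨⟨-, h1⟩, h2, -⟩
        exact ⟨h2, h1⟩
      · rintro ⟨h2, h1⟩
        exact ⟨⟨fun h3 => h0 (h3 ▸ h2), h1⟩, h2, fun _ => trivial⟩
    · rw [Finset.card_eq_zero, Finset.filter_eq_empty_iff]
      rintro v - ⟨h1, h2⟩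
      exact h ⟨h1.1, h2.2⟩

theorem signedRange_mem_configurations {k : ℕ} (hk : 2 * k = 20) {x : Fin k → V5}
    (hx : IsProjective x) (hspan : rangeSpan x = ⊤) : signedRange x ∈ configurations :=
  mem_configurations.2 ⟨zero_notMem_signedRange hx, fun _ => neg_mem_signedRange,
    (card_signedRange hx).trans hk, by rw [span_signedRange, hspan]⟩

open Classical in
-- Every configuration arises from all orderings and sign choices of its ten points, and each such
-- tuple is projective and spanning.
theorem card_configurations_mul_le {k : ℕ} (hk : 2 * k = 20) :
    configurations.card * ∏ i ∈ Finset.range k, (20 - 2 * i) ≤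
    (Finset.univ.filter fun x : Fin k → V5 =>
      IsProjective x ∧ Module.finrank (ZMod 3) (rangeSpan x) = 5).card := by
  have htop : ∀ x : Fin k → V5, Module.finrank (ZMod 3) (rangeSpan x) = 5 ↔
      rangeSpan x = ⊤ := fun x => by
    constructor
    · intro h
      refine Submodule.eq_top_of_finrank_eq ?_
      rw [h]
      simp
    · intro h
      rw [h]
      simp
  rw [Finset.card_eq_sum_card_fiberwise (f := signedRange) (t := configurations) fun x hx => by
    have h : IsProjective x ∧ Module.finrank (ZMod 3) (rangeSpan x) = 5 := by simpa using hx
    exact signedRange_mem_configurations hk h.1 ((htop x).1 h.2)]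
  rw [← smul_eq_mul, ← Finset.sum_const]
  refine Finset.sum_le_sum fun S hS => ?_
  obtain ⟨h0, hneg, hcard, hspan⟩ := mem_configurations.1 hS
  rw [← hcard, ← card_tuples_in S h0 hneg k]
  refine Finset.card_le_card fun x hx => ?_
  have h7 : IsProjective x ∧ ∀ i, x i ∈ S := by simpa using hx
  obtain ⟨hx1, hx2⟩ := h7
  have h3 : signedRange x = S :=
    Finset.eq_of_subset_of_card_le (signedRange_subset hneg hx2) (by
      rw [card_signedRange hx1, hcard, hk])
  simp only [Finset.mem_filter, Finset.mem_univ, true_and]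
  exact ⟨⟨hx1, by rw [htop, ← span_signedRange, h3, hspan]⟩, h3⟩

theorem card_configurations_le : configurations.card ≤ 126422205423228 := by
  have h1 := (card_configurations_mul_le (k := 10) rfl).trans (card_tuples_le 10 5)
  -- The factor 3715891200 is `2 ^ 10 * 10!`, the number of signed orderings of ten points.
  have h2 : tupleCount 10 5 = 126422205423228 * 3715891200 := by decide +kernel
  have h3 : ∏ i ∈ Finset.range 10, (20 - 2 * i) = 3715891200 := by
    simp [Finset.prod_range_succ]
  rw [h2, h3] at h1
  exact Nat.le_of_mul_le_mul_right h1 (by norm_num)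

/-! ### Group order and the mass argument -/

theorem card_G5 : Nat.card G5 = 475566474240 := by
  have e : G5 ≃ Matrix.GeneralLinearGroup (Fin 5) (ZMod 3) :=
    (LinearMap.GeneralLinearGroup.generalLinearEquiv (ZMod 3) V5).symm.toEquiv.trans
      Matrix.GeneralLinearGroup.toLin.symm.toEquiv
  rw [Nat.card_congr e, Matrix.card_GL_field, ZMod.card]
  decide

theorem smul_mem_configurations {S : Finset V5} (hS : S ∈ configurations) (g : G5) :
    g • S ∈ configurations := by
  obtain ⟨h0, hneg, hcard, hspan⟩ := mem_configurations.1 hS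
  refine mem_configurations.2 ⟨fun h => h0 ?_, fun v hv => ?_, ?_, ?_⟩
  · rwa [← smul_zero g, Finset.smul_mem_smul_finset_iff] at h
  · obtain ⟨w, hw, rfl⟩ := Finset.mem_smul_finset.1 hv
    rw [← smul_neg]
    exact Finset.smul_mem_smul_finset (hneg w hw)
  · rw [Finset.card_smul_finset, hcard]
  · have h1 : ((g • S : Finset V5) : Set V5) = (g : V5 →ₗ[ZMod 3] V5) '' (S : Set V5) := by
      rw [Finset.coe_smul_finset]
      rfl
    rw [h1, Submodule.span_image, hspan, Submodule.map_top, LinearEquiv.range]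

/-- If the invariants of the sets `S i` are distinct and the bounds for their orbits exhaust all
configurations, then every configuration is in the orbit of some `S i`. -/
theorem exists_smul_eq {n : ℕ} (S : Fin n → Finset V5) (r : Fin n → Bool)
    (hS : ∀ i, S i ∈ configurations) (he : ∀ i, ∀ k : Fin 5, Pi.single k 1 ∈ S i)
    (hinv : Function.Injective fun i => invariant (S i))
    (hmass : ∑ i, 475566474240 / stabilizerBound (S i) (r i) = 126422205423228)
    {T : Finset V5} (hT : T ∈ configurations) : ∃ i, ∃ g : G5, g • S i = T := by
  classical
  let O : Fin n → Finset (Finset V5) := fun i => Finset.univ.image fun g : G5 => g • S i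
  have hO : ∀ i, (O i).card = Nat.card (MulAction.orbit G5 (S i)) := fun i => by
    rw [← Nat.card_eq_finsetCard]
    refine Nat.card_congr (Equiv.subtypeEquivRight fun T => ?_)
    simp [O, MulAction.mem_orbit_iff]
  have hdisj : Set.PairwiseDisjoint (Finset.univ : Finset (Fin n)) O := by
    intro i _ j _ hij
    rw [Function.onFun, Finset.disjoint_left]
    intro T hi hj
    obtain ⟨g, -, rfl⟩ := Finset.mem_image.1 hi
    obtain ⟨g', -, h⟩ := Finset.mem_image.1 hj
    refine hij (hinv ?_)
    change invariant (S i) = invariant (S j)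
    rw [← invariant_smul g, ← h, invariant_smul]
  have hsub : Finset.univ.biUnion O ⊆ configurations := by
    intro T hT
    obtain ⟨i, -, hi⟩ := Finset.mem_biUnion.1 hT
    obtain ⟨g, -, rfl⟩ := Finset.mem_image.1 hi
    exact smul_mem_configurations (hS i) g
  -- The orbits are disjoint, and lower bounds for their sizes already add up to the upper bound for
  -- all configurations.
  have hcard : configurations.card ≤ (Finset.univ.biUnion O).card := by
    rw [Finset.card_biUnion hdisj]
    refine card_configurations_le.trans (hmass.symm.le.trans (Finset.sum_le_sum fun i _ => ?_))
    rw [hO, ← card_G5]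
    exact div_stabilizerBound_le _ _ (he i)
  rw [← Finset.eq_of_subset_of_card_le hsub hcard] at hT
  obtain ⟨i, -, hi⟩ := Finset.mem_biUnion.1 hT
  obtain ⟨g, -, h⟩ := Finset.mem_image.1 hi
  exact ⟨i, g, h⟩

/-! ### Codes and configurations -/

/-- The code with the entries of `x` as columns of a parity check matrix. -/
def toCode (x : Fin 10 → V5) : Submodule (ZMod 3) (Fin 10 → ZMod 3) :=
  LinearMap.ker (Fintype.linearCombination (ZMod 3) x)

theorem mem_toCode {x : Fin 10 → V5} {c : Fin 10 → ZMod 3} :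
    c ∈ toCode x ↔ ∑ i, c i • x i = 0 := by
  rw [toCode, LinearMap.mem_ker, Fintype.linearCombination_apply]

theorem range_linearCombination_eq_top {x : Fin 10 → V5} (hx : rangeSpan x = ⊤) :
    LinearMap.range (Fintype.linearCombination (ZMod 3) x) = ⊤ := by
  rw [Fintype.range_linearCombination, ← hx]

theorem finrank_toCode {x : Fin 10 → V5} (hx : rangeSpan x = ⊤) :
    Module.finrank (ZMod 3) (toCode x) = 5 := by
  have h := LinearMap.finrank_range_add_finrank_ker (Fintype.linearCombination (ZMod 3) x)
  rw [range_linearCombination_eq_top hx, finrank_top, Module.finrank_fin_fun,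
    Module.finrank_fin_fun] at h
  have h' : 5 + Module.finrank (ZMod 3) (toCode x) = 10 := h
  omega

/-- The quotient by `C` has dimension 5; identified with `V5`, the quotient map has kernel `C`, and
the images of the unit vectors are the columns. -/
theorem exists_toCode_eq {C : Submodule (ZMod 3) (Fin 10 → ZMod 3)}
    (hC : Module.finrank (ZMod 3) C = 5) : ∃ x : Fin 10 → V5, rangeSpan x = ⊤ ∧ toCode x = C := by
  have h1 : Module.finrank (ZMod 3) ((Fin 10 → ZMod 3) ⧸ C) = Module.finrank (ZMod 3) V5 := by
    have := Submodule.finrank_quotient_add_finrank C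
    rw [hC, Module.finrank_fin_fun] at this
    rw [Module.finrank_fin_fun]
    omega
  let e := LinearEquiv.ofFinrankEq _ _ h1
  let f : (Fin 10 → ZMod 3) →ₗ[ZMod 3] V5 := e.toLinearMap ∘ₗ C.mkQ
  have h2 : Fintype.linearCombination (ZMod 3) (fun i => f (Pi.single i 1)) = f := by
    refine LinearMap.pi_ext' fun i => LinearMap.ext_ring ?_
    simp [Fintype.linearCombination_apply, Pi.single_apply]
  refine ⟨fun i => f (Pi.single i 1), ?_, ?_⟩
  · rw [rangeSpan, ← Fintype.range_linearCombination, h2, LinearMap.range_comp, Submodule.range_mkQ,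
      Submodule.map_top, LinearEquiv.range]
  · rw [toCode, h2, LinearMap.ker_comp, LinearEquiv.ker, Submodule.comap_bot, Submodule.ker_mkQ]

/-- Both matrices define surjections onto `V5` with the same kernel, hence identify `V5` with the
same quotient. -/
theorem exists_equiv_of_toCode_eq {x y : Fin 10 → V5} (hx : rangeSpan x = ⊤) (hy : rangeSpan y = ⊤)
    (h : toCode x = toCode y) : ∃ g : G5, ∀ i, y i = g (x i) := by
  let fx := Fintype.linearCombination (ZMod 3) x
  let fy := Fintype.linearCombination (ZMod 3) y
  have hk : LinearMap.ker fx = LinearMap.ker fy := h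
  let ex := fx.quotKerEquivOfSurjective (LinearMap.range_eq_top.1 (range_linearCombination_eq_top hx))
  let ey := fy.quotKerEquivOfSurjective (LinearMap.range_eq_top.1 (range_linearCombination_eq_top hy))
  refine ⟨(ex.symm.trans (Submodule.quotEquivOfEq _ _ hk)).trans ey, fun i => ?_⟩
  have h1 : ∀ c, ex (Submodule.Quotient.mk c) = fx c := fun c => rfl
  have h2 : ∀ c, ey (Submodule.Quotient.mk c) = fy c := fun c => rfl
  have h3 : x i = fx (Pi.single i 1) := by
    simp [fx]
  have h4 : y i = fy (Pi.single i 1) := by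
    simp [fy]
  rw [h3, h4, ← h1, ← h2]
  simp only [LinearEquiv.trans_apply, LinearEquiv.symm_apply_apply, Submodule.quotEquivOfEq_mk]

/-- The effect of a signed permutation on the columns of a parity check matrix. -/
def signedReindex (σ : Equiv.Perm (Fin 10)) (ε : Fin 10 → ℤˣ) (x : Fin 10 → V5) : Fin 10 → V5 :=
  fun i => (((ε i : ℤ) : ZMod 3)) • x (σ i)

theorem sign_mul_self (u : ℤˣ) : ((u : ℤ) : ZMod 3) * ((u : ℤ) : ZMod 3) = 1 := by
  rcases Int.units_eq_one_or u with rfl | rfl <;> simp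

/-- Coordinates and columns receive the same permutation and the same signs. As signs square to 1,
the linear relation is unchanged. -/
theorem map_signedPerm_toCode (σ : Equiv.Perm (Fin 10)) (ε : Fin 10 → ℤˣ) (x : Fin 10 → V5) :
    (toCode x).map (signedPerm σ ε) = toCode (signedReindex σ ε x) := by
  have h1 : ∀ c, signedPerm σ ε c ∈ toCode (signedReindex σ ε x) ↔ c ∈ toCode x := fun c => by
    rw [mem_toCode, mem_toCode]
    have : ∑ i, signedPerm σ ε c i • signedReindex σ ε x i = ∑ i, c (σ i) • x (σ i) := by
      refine Finset.sum_congr rfl fun i _ => ?_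
      change (_ * c (σ i)) • _ • x (σ i) = _
      rw [smul_smul, mul_right_comm, sign_mul_self, one_mul]
    rw [this, Equiv.sum_comp σ fun i => c i • x i]
  have h2 : ∀ d, signedPerm σ ε (signedPerm σ⁻¹ (fun i => ε (σ⁻¹ i)) d) = d := fun d => by
    rw [← LinearMap.comp_apply, signedPerm_comp]
    simp [Int.units_mul_self, signedPerm_one]
  ext d
  rw [Submodule.mem_map]
  constructor
  · rintro ⟨c, hc, rfl⟩
    exact (h1 c).2 hc
  · intro hd
    refine ⟨signedPerm σ⁻¹ (fun i => ε (σ⁻¹ i)) d, ?_, h2 d⟩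
    rw [← h1, h2]
    exact hd

theorem signedRange_signedReindex (σ : Equiv.Perm (Fin 10)) (ε : Fin 10 → ℤˣ) (x : Fin 10 → V5) :
    signedRange (signedReindex σ ε x) = signedRange x := by
  have h : ∀ i, signedReindex σ ε x i = x (σ i) ∨ signedReindex σ ε x i = -x (σ i) := fun i => by
    rcases Int.units_eq_one_or (ε i) with h | h <;> simp [signedReindex, h]
  ext v
  rw [mem_signedRange, mem_signedRange]
  constructor
  · rintro ⟨i, hi⟩
    refine ⟨σ i, ?_⟩
    rcases h i with h' | h' <;> rw [h'] at hi
    · exact hi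
    · rwa [neg_neg, or_comm] at hi
  · rintro ⟨i, hi⟩
    refine ⟨σ.symm i, ?_⟩
    have h1 := h (σ.symm i)
    rw [σ.apply_symm_apply] at h1
    rcases h1 with h' | h' <;> rw [h']
    · exact hi
    · rwa [neg_neg, or_comm]

theorem signedRange_smul (g : G5) (x : Fin 10 → V5) :
    signedRange (fun i => g (x i)) = g • signedRange x := by
  ext v
  simp only [mem_signedRange, Finset.mem_smul_finset]
  constructor
  · rintro ⟨i, rfl | rfl⟩
    · exact ⟨x i, ⟨i, .inl rfl⟩, rfl⟩
    · exact ⟨-x i, ⟨i, .inr rfl⟩, map_neg g _⟩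
  · rintro ⟨w, ⟨i, rfl | rfl⟩, rfl⟩
    · exact ⟨i, .inl rfl⟩
    · exact ⟨i, .inr (map_neg g _)⟩

theorem rangeSpan_eq_top_of_signedRange_eq {x y : Fin 10 → V5} (hx : rangeSpan x = ⊤)
    (h : signedRange y = signedRange x) : rangeSpan y = ⊤ := by
  rw [← span_signedRange, h, span_signedRange, hx]

theorem exists_smul_eq_of_equivalent {x y : Fin 10 → V5} (hx : rangeSpan x = ⊤)
    (hy : rangeSpan y = ⊤) (h : Equivalent (toCode x) (toCode y)) :
    ∃ g : G5, g • signedRange x = signedRange y := by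
  obtain ⟨σ, ε, h⟩ := h
  rw [map_signedPerm_toCode] at h
  have h1 := signedRange_signedReindex σ ε x
  obtain ⟨g, hg⟩ := exists_equiv_of_toCode_eq (rangeSpan_eq_top_of_signedRange_eq hx h1) hy h.symm
  exact ⟨g, by rw [← h1, ← signedRange_smul, funext hg]⟩

theorem toCode_equiv (g : G5) (x : Fin 10 → V5) : toCode (fun i => g (x i)) = toCode x := by
  ext c
  rw [mem_toCode, mem_toCode, ← g.map_eq_zero_iff (x := ∑ i, c i • x i)]
  simp

/-- Each `y i` is `± g (x j)` for some `j`. Projectivity of `y` makes `i ↦ j` injective, hence a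
permutation, and `g` does not affect the kernel. -/
theorem equivalent_of_smul_eq {x y : Fin 10 → V5} (hy : IsProjective y) {g : G5}
    (h : g • signedRange x = signedRange y) : Equivalent (toCode x) (toCode y) := by
  have h1 : ∀ i, ∃ (j : Fin 10) (u : ℤˣ), y i = ((u : ℤ) : ZMod 3) • g (x j) := fun i => by
    have h2 : y i ∈ g • signedRange x := by
      rw [h]
      exact mem_signedRange.2 ⟨i, .inl rfl⟩
    rw [← signedRange_smul] at h2
    obtain ⟨j, hj | hj⟩ := mem_signedRange.1 h2
    · exact ⟨j, 1, by simp [hj]⟩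
    · exact ⟨j, -1, by simp [hj]⟩
  choose σ ε hσ using h1
  have hinj : Function.Injective σ := fun i j hij => by
    by_contra hne
    have h3 := hy.2 i j hne
    rw [hσ i, hσ j, hij] at h3
    rcases Int.units_eq_one_or (ε i) with h4 | h4 <;> rcases Int.units_eq_one_or (ε j) with h5 | h5 <;>
      simp [h4, h5] at h3
  refine ⟨Equiv.ofBijective σ (Finite.injective_iff_bijective.1 hinj), ε, ?_⟩
  rw [map_signedPerm_toCode, ← toCode_equiv g (signedReindex _ _ _)]
  congr 1
  funext i
  rw [hσ i]
  simp [signedReindex]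

/-! ### Minimum weight and projectivity -/

/-- All nonzero words of `C` have weight at least `t`. -/
def MinWeightGe (C : Submodule (ZMod 3) (Fin 10 → ZMod 3)) (t : ℕ) : Prop :=
  ∀ c ∈ C, c ≠ 0 → t ≤ hammingNorm c

theorem isMinWeight_iff {C : Submodule (ZMod 3) (Fin 10 → ZMod 3)} {d : ℕ} :
    IsMinWeight C d ↔ MinWeightGe C d ∧ ¬ MinWeightGe C (d + 1) := by
  constructor
  · rintro ⟨⟨c, hc, h0, hw⟩, h2⟩
    refine ⟨fun c hc h0 => h2 ⟨c, hc, h0, rfl⟩, fun h => ?_⟩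
    have := h c hc h0
    omega
  · rintro ⟨h1, h2⟩
    simp only [MinWeightGe, not_forall] at h2
    obtain ⟨c, hc, h0, hw⟩ := h2
    refine ⟨⟨c, hc, h0, le_antisymm (by omega) (h1 c hc h0)⟩, ?_⟩
    rintro _ ⟨c, hc, h0, rfl⟩
    exact h1 c hc h0

theorem MinWeightGe.mono {C : Submodule (ZMod 3) (Fin 10 → ZMod 3)} {s t : ℕ}
    (h : MinWeightGe C t) (hst : s ≤ t) : MinWeightGe C s :=
  fun c hc h0 => hst.trans (h c hc h0)

/-- A zero column, or two columns equal up to sign, would give a nonzero word of weight at most 2.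
-/
theorem isProjective_of_minWeightGe {x : Fin 10 → V5} (h : MinWeightGe (toCode x) 3) :
    IsProjective x := by
  -- The alternative `b = 0` allows `i = j` and covers a zero column.
  have key : ∀ i j (a b : ZMod 3), a ≠ 0 → (i ≠ j ∨ b = 0) → a • x i + b • x j = 0 → False := by
    intro i j a b ha hb hab
    have h1 : (Pi.single i a + Pi.single j b : Fin 10 → ZMod 3) ∈ toCode x := by
      rw [mem_toCode]
      simp [add_smul, Finset.sum_add_distrib, Pi.single_apply, hab]
    have h2 := h _ h1 fun h0 => by
      have := congrFun h0 i
      rcases hb with hb | hb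
      · simp [hb, ha] at this
      · simp [hb, ha] at this
    have h3 : hammingNorm (Pi.single i a + Pi.single j b : Fin 10 → ZMod 3) ≤ 2 := by
      refine (Finset.card_le_card fun k hk => ?_).trans (Finset.card_le_two (a := i) (b := j))
      by_contra hk'
      simp only [Finset.mem_insert, Finset.mem_singleton, not_or] at hk'
      simp [Pi.single_apply, hk'] at hk
    omega
  refine ⟨fun i hi => key i i 1 0 one_ne_zero (.inr rfl) (by simp [hi]), fun i j hij => ⟨?_, ?_⟩⟩
  · intro hx
    exact key i j 1 (-1) one_ne_zero (.inl hij) (by simp [hx])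
  · intro hx
    exact key i j 1 1 one_ne_zero (.inl hij) (by simp [hx])

/-! ### Codes in systematic form -/

/-- The `j`-th column of the matrix numbered `a`. -/
def col (a : ℕ) (j : Fin 5) : V5 := fun k => (digit a (5 * j + k) : ZMod 3)

/-- The `k`-th row of the matrix numbered `a`. -/
def row (a : ℕ) (k : Fin 5) : V5 := fun j => (digit a (5 * j + k) : ZMod 3)

/-- The standard basis of `𝔽₃⁵`. -/
def std (k : Fin 5) : V5 := Pi.single k 1

/-- The standard basis, followed by the columns of the matrix numbered `a`. -/
def systematic (a : ℕ) : Fin 10 → V5 := Fin.append std (col a)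

/-- The word of the code of `systematic a` with given values at the last five positions. -/
def wordOf (a : ℕ) (h : D5) : Fin 10 → ZMod 3 :=
  Fin.append (fun k => -h (row a k)) fun j => h (std j)

theorem rangeSpan_systematic (a : ℕ) : rangeSpan (systematic a) = ⊤ := by
  rw [eq_top_iff, ← (Pi.basisFun (ZMod 3) (Fin 5)).span_eq]
  refine Submodule.span_mono ?_
  rintro _ ⟨k, rfl⟩
  exact ⟨Fin.castAdd 5 k, (Fin.append_left std (col a) k).trans
    (Pi.basisFun_apply (ZMod 3) (Fin 5) k).symm⟩

theorem functional_eq_sum (h : D5) (v : V5) : h v = ∑ j, v j * h (std j) := by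
  conv_lhs => rw [pi_eq_sum_univ' v]
  simp [std]

theorem sum_append {M : Type*} [AddCommMonoid M] (f : Fin 10 → M) :
    ∑ i, f i = (∑ k : Fin 5, f (Fin.castAdd 5 k)) + ∑ j : Fin 5, f (Fin.natAdd 5 j) :=
  Fin.sum_univ_add (a := 5) (b := 5) f

/-- The last five positions are information positions: a functional is given by its values there,
and the identity block solves for the first five. -/
theorem mem_toCode_systematic (a : ℕ) (c : Fin 10 → ZMod 3) :
    c ∈ toCode (systematic a) ↔ ∃ h, c = wordOf a h := by
  have hl : ∀ k, systematic a (Fin.castAdd 5 k) = std k := Fin.append_left std (col a)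
  have hr : ∀ k, systematic a (Fin.natAdd 5 k) = col a k := Fin.append_right std (col a)
  have h1 : c ∈ toCode (systematic a) ↔
      ∀ k, c (Fin.castAdd 5 k) + ∑ j : Fin 5, c (Fin.natAdd 5 j) * col a j k = 0 := by
    rw [mem_toCode, sum_append, funext_iff]
    refine forall_congr' fun k => ?_
    have h2 : ∑ i, c (Fin.castAdd 5 i) * std i k = c (Fin.castAdd 5 k) := by
      simp [std, Pi.single_apply]
    simp only [hl, hr, Pi.add_apply, Finset.sum_apply, Pi.smul_apply, smul_eq_mul, Pi.zero_apply,
      h2]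
  rw [h1]
  constructor
  · intro hc
    let h : D5 := Fintype.linearCombination (ZMod 3) fun j => c (Fin.natAdd 5 j)
    have hh : ∀ j, h (std j) = c (Fin.natAdd 5 j) := fun j => by simp [h, std]
    refine ⟨h, funext fun i => ?_⟩
    refine Fin.addCases (m := 5) (n := 5) (fun k => ?_) (fun j => ?_) i
    · refine (eq_neg_of_add_eq_zero_left (hc k)).trans ?_
      refine Eq.trans ?_ (Fin.append_left (fun k => -h (row a k)) (fun j => h (std j)) k).symm
      rw [functional_eq_sum]
      simp only [hh]
      exact congrArg _ (Finset.sum_congr rfl fun j _ => mul_comm _ _)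
    · exact (hh j).symm.trans (Fin.append_right (fun k => -h (row a k)) (fun j => h (std j)) j).symm
  · rintro ⟨h, rfl⟩ k
    have e1 : ∀ k, wordOf a h (Fin.castAdd 5 k) = -h (row a k) := Fin.append_left _ _
    have e2 : ∀ k, wordOf a h (Fin.natAdd 5 k) = h (std k) := Fin.append_right _ _
    simp only [e1, e2]
    rw [functional_eq_sum, neg_add_eq_zero]
    exact Finset.sum_congr rfl fun j _ => mul_comm _ _

theorem wordOf_eq_zero {a : ℕ} {h : D5} : wordOf a h = 0 ↔ h = 0 := by
  constructor
  · intro h0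
    refine LinearMap.ext fun v => ?_
    rw [functional_eq_sum]
    refine Finset.sum_eq_zero fun j _ => ?_
    have e2 : wordOf a h (Fin.natAdd 5 j) = h (std j) := Fin.append_right _ _ j
    rw [← e2, h0]
    simp
  · rintro rfl
    funext i
    refine Fin.addCases (m := 5) (n := 5) (fun k => ?_) (fun j => ?_) i
    · exact (Fin.append_left (fun k => -(0 : D5) (row a k)) (fun j => (0 : D5) (std j)) k).trans
        (by simp)
    · exact (Fin.append_right (fun k => -(0 : D5) (row a k)) (fun j => (0 : D5) (std j)) j).trans
        (by simp)

theorem hammingNorm_wordOf (a : ℕ) (h : D5) : hammingNorm (wordOf a h) =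
    ∑ i, if h ((Fin.append std (row a) : Fin 10 → V5) i) = 0 then 0 else 1 := by
  have e0 : ∀ c : Fin 10 → ZMod 3, hammingNorm c = ∑ i, if c i = 0 then 0 else 1 := fun c => by
    rw [hammingNorm, Finset.card_filter]
    simp
  have e1 : ∀ k, wordOf a h (Fin.castAdd 5 k) = -h (row a k) := Fin.append_left _ _
  have e2 : ∀ k, wordOf a h (Fin.natAdd 5 k) = h (std k) := Fin.append_right _ _
  have e3 : ∀ k, (Fin.append std (row a) : Fin 10 → V5) (Fin.castAdd 5 k) = std k :=
    Fin.append_left _ _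
  have e4 : ∀ k, (Fin.append std (row a) : Fin 10 → V5) (Fin.natAdd 5 k) = row a k :=
    Fin.append_right _ _
  rw [e0, sum_append, sum_append]
  simp only [e1, e2, e3, e4, neg_eq_zero]
  exact add_comm _ _

/-- The numbers of the entries of `systematic a`. -/
def pointCodes (a : ℕ) : List ℕ :=
  [1, 3, 9, 27, 81, Nat.mod a 243, Nat.mod (Nat.div a 243) 243, Nat.mod (Nat.div a 59049) 243,
    Nat.mod (Nat.div a 14348907) 243, Nat.mod (Nat.div a 3486784401) 243]

/-- The number of the row of the matrix numbered `a` that starts with the last digit of `a`. -/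
def rowCode (a : ℕ) : ℕ :=
  Nat.add (Nat.mod a 3) (Nat.add (Nat.mul (Nat.mod (Nat.div a 243) 3) 3)
    (Nat.add (Nat.mul (Nat.mod (Nat.div a 59049) 3) 9)
    (Nat.add (Nat.mul (Nat.mod (Nat.div a 14348907) 3) 27)
    (Nat.mul (Nat.mod (Nat.div a 3486784401) 3) 81))))

/-- The numbers of the standard basis vectors and the rows of the matrix numbered `a`. -/
def wordCodes (a : ℕ) : List ℕ :=
  [1, 3, 9, 27, 81, rowCode a, rowCode (Nat.div a 3), rowCode (Nat.div a 9),
    rowCode (Nat.div a 27), rowCode (Nat.div a 81)]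

theorem nat_mod_eq (m n : ℕ) : Nat.mod m n = m % n := rfl

theorem nat_div_eq (m n : ℕ) : Nat.div m n = m / n := rfl

theorem map_vec_std : [1, 3, 9, 27, 81].map vec = List.ofFn std := by
  decide

theorem map_vec_pointCodes (a : ℕ) : (pointCodes a).map vec = List.ofFn (systematic a) := by
  refine Eq.trans ?_ (List.ofFn_fin_append std (col a)).symm
  rw [← map_vec_std]
  simp only [pointCodes, List.map_cons, List.map_nil, List.cons_append, List.nil_append,
    List.ofFn_succ, List.ofFn_zero, List.cons.injEq, true_and, and_true]
  refine ⟨?_, ?_, ?_, ?_, ?_⟩ <;> funext k <;> refine congrArg (Nat.cast (R := ZMod 3)) ?_ <;>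
    (simp only [digit, nat_mod_eq, nat_div_eq]; fin_cases k <;> norm_num <;> omega)

/-- The matrix is stored column by column, so a row consists of every fifth digit; dividing by `3 ^
k` first gives row `k`. -/
theorem digit_rowCode (a : ℕ) (j : Fin 5) : digit (rowCode a) j = digit a (5 * j) := by
  have key : ∀ d₀ d₁ d₂ d₃ d₄ : ℕ, d₀ < 3 → d₁ < 3 → d₂ < 3 → d₃ < 3 → d₄ < 3 →
      ∀ j : Fin 5, digit (d₀ + (d₁ * 3 + (d₂ * 9 + (d₃ * 27 + d₄ * 81)))) j
        = ![d₀, d₁, d₂, d₃, d₄] j := by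
    intro d₀ d₁ d₂ d₃ d₄ h₀ h₁ h₂ h₃ h₄ j
    fin_cases j <;> simp [digit] <;> omega
  have h := key _ _ _ _ _ (digit_lt a 0) (digit_lt a 5) (digit_lt a 10) (digit_lt a 15)
    (digit_lt a 20) j
  have e : rowCode a = digit a 0 + (digit a 5 * 3 + (digit a 10 * 9 + (digit a 15 * 27
      + digit a 20 * 81))) := by
    simp [rowCode, digit, nat_mod_eq, nat_div_eq]
  rw [e, h]
  fin_cases j <;> rfl

theorem digit_div (a k l : ℕ) : digit (a / 3 ^ k) l = digit a (l + k) := by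
  rw [digit, digit, Nat.div_div_eq_div_mul, ← pow_add, add_comm]

theorem map_vec_wordCodes (a : ℕ) :
    (wordCodes a).map vec = List.ofFn (Fin.append std (row a) : Fin 10 → V5) := by
  refine Eq.trans ?_ (List.ofFn_fin_append std (row a)).symm
  have h : ∀ k : Fin 5, vec (rowCode (a / 3 ^ (k : ℕ))) = row a k := fun k =>
    funext fun j => congrArg (Nat.cast (R := ZMod 3)) (by rw [digit_rowCode, digit_div])
  rw [← map_vec_std, ← funext h]
  simp [wordCodes, List.ofFn_succ, nat_div_eq]

theorem mem_signedVectors {l : List ℕ} {v : V5} :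
    v ∈ signedVectors l ↔ ∃ w ∈ l.map vec, v = w ∨ v = -w := by
  simp [signedVectors]

theorem toFinset_signedVectors (a : ℕ) :
    (signedVectors (pointCodes a)).toFinset = signedRange (systematic a) := by
  ext v
  rw [List.mem_toFinset, mem_signedVectors, map_vec_pointCodes, mem_signedRange]
  simp only [List.mem_ofFn', Set.mem_range, exists_exists_eq_and]

/-- If `h v ≠ 0`, then `h` takes the value 1 at exactly one of `v` and `-v`; otherwise at neither.
-/
theorem listWeight_signedVectors {l : List ℕ} {y : Fin 10 → V5} (hl : l.map vec = List.ofFn y)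
    (h : D5) : listWeight (signedVectors l) h = ∑ i, if h (y i) = 0 then 0 else 1 := by
  have h1 : listWeight (signedVectors l) h
      = ((l.map vec).map fun v => if h v = 0 then 0 else 1).sum := by
    clear hl
    induction l with
    | nil => rfl
    | cons a l ih =>
      change listWeight (vec a :: -vec a :: signedVectors l) h = _
      rw [listWeight_cons, listWeight_cons, ih, List.map_cons, List.map_cons, List.sum_cons,
        ← add_assoc, map_neg]
      congr 1
      generalize h (vec a) = t
      revert t
      decide
  rw [h1, hl, List.map_ofFn, List.sum_ofFn]
  rfl

theorem length_pointVectors (a : ℕ) : (signedVectors (pointCodes a)).length = 20 :=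
  length_signedVectors _

theorem nodup_pointVectors {a : ℕ} (h : IsProjective (systematic a)) :
    (signedVectors (pointCodes a)).Nodup := by
  rw [← Multiset.coe_nodup, ← Multiset.toFinset_card_eq_card_iff_nodup]
  exact (congrArg Finset.card (toFinset_signedVectors a)).trans
    ((card_signedRange h).trans (length_pointVectors a).symm)

/-- The test for all nonzero words to have weight at least `t`. -/
noncomputable def heavyCode (a t : ℕ) : Bool :=
  Nat.beq (countHeavy t (weightLanes (masks (wordCodes a)))) 242

/-- There are `3 ^ 5 - 1 = 242` nonzero functionals. The zero functional has weight 0 and is not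
counted because `t` is positive, so the count is 242 exactly when all nonzero words are heavy
enough. -/
theorem heavyCode_iff {a t : ℕ} (ht : t ≤ 20) (ht' : 0 < t) :
    heavyCode a t = true ↔ MinWeightGe (toCode (systematic a)) t := by
  have hw : ∀ h, listWeight (signedVectors (wordCodes a)) h = hammingNorm (wordOf a h) :=
    fun h => by rw [hammingNorm_wordOf, listWeight_signedVectors (map_vec_wordCodes a)]
  have h1 : MinWeightGe (toCode (systematic a)) t ↔
      ∀ h : D5, h ≠ 0 → t ≤ listWeight (signedVectors (wordCodes a)) h := by
    constructor
    · intro H h h0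
      rw [hw]
      exact H _ ((mem_toCode_systematic a _).2 ⟨h, rfl⟩) fun h' => h0 (wordOf_eq_zero.1 h')
    · intro H c hc h0
      obtain ⟨h, rfl⟩ := (mem_toCode_systematic a _).1 hc
      rw [← hw]
      exact H h fun h' => h0 (wordOf_eq_zero.2 h')
  rw [h1, heavyCode, masks_eq, countHeavy_eq (length_signedVectors _).le ht, Nat.beq_eq]
  have h2 : Fintype.card D5 = 243 := by
    rw [← Fintype.card_of_bijective functional_bijective, Fintype.card_fin]
  have h3 : (Finset.univ.erase (0 : D5)).card = 242 := by
    rw [Finset.card_erase_of_mem (Finset.mem_univ _), Finset.card_univ, h2]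
  have h4 : (Finset.univ.filter fun h : D5 => t ≤ listWeight (signedVectors (wordCodes a)) h)
      ⊆ Finset.univ.erase 0 := by
    intro h hh
    refine Finset.mem_erase.2 ⟨?_, Finset.mem_univ _⟩
    rintro rfl
    have := (Finset.mem_filter.1 hh).2
    rw [hw, wordOf_eq_zero.2 rfl, hammingNorm_zero] at this
    omega
  constructor
  · intro h5 h h0
    have h6 := Finset.eq_of_subset_of_card_le h4 (by rw [h3, h5])
    have : h ∈ Finset.univ.erase (0 : D5) := Finset.mem_erase.2 ⟨h0, Finset.mem_univ _⟩
    rw [← h6] at this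
    exact (Finset.mem_filter.1 this).2
  · intro H
    rw [← h3]
    refine congrArg Finset.card (Finset.Subset.antisymm h4 fun h hh => ?_)
    exact Finset.mem_filter.2 ⟨Finset.mem_univ _, H h (Finset.mem_erase.1 hh).1⟩

/-! ### Lists of representatives -/

/-- The matrix for which the fine version of the colours is used. -/
def usesFineColours (a : ℕ) : Bool := Nat.beq a 541131493279

/-- The lanes of the colours of the functionals, in the version chosen for `a`. -/
noncomputable def chosenLanes (a : ℕ) (ms : List ℕ) : ℕ :=
  @Bool.rec (fun _ => ℕ) (colourLanes false ms) (colourLanes true ms) (usesFineColours a)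

theorem chosenLanes_eq (a : ℕ) (ms : List ℕ) :
    chosenLanes a ms = colourLanes (usesFineColours a) ms := by
  rw [chosenLanes]
  cases usesFineColours a <;> rfl

/-- The sum of `f` along a list. -/
noncomputable def sumCode (f : ℕ → ℕ) (l : List ℕ) : ℕ := listFold (fun a s => Nat.add (f a) s) 0 l

/-- The number of entries of a list with a given property. -/
noncomputable def countCode (p : ℕ → Bool) (l : List ℕ) : ℕ :=
  listFold (fun a s => Nat.add (@Bool.rec (fun _ => ℕ) 0 1 (p a)) s) 0 l

/-- All entries of a list have a given property. -/
noncomputable def allCode (p : ℕ → Bool) (l : List ℕ) : Bool :=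
  listFold (fun a b => and (p a) b) true l

/-- The values of `f` along `l` increase strictly from at least `lo` to less than `hi`. -/
noncomputable def ascending (f : ℕ → ℕ) (hi : ℕ) (l : List ℕ) (lo : ℕ) : Bool :=
  listFold (β := ℕ → Bool) (fun a k lo => and (Nat.ble lo (f a)) (k (Nat.succ (f a))))
    (fun lo => Nat.ble lo hi) l lo

theorem sumCode_eq (f : ℕ → ℕ) (l : List ℕ) : sumCode f l = (l.map f).sum := by
  induction l with
  | nil => rfl
  | cons a l ih =>
    rw [List.map_cons, List.sum_cons, ← ih]
    rfl

theorem countCode_eq (p : ℕ → Bool) (l : List ℕ) :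
    countCode p l = (l.map fun a => if p a = true then 1 else 0).sum := by
  induction l with
  | nil => rfl
  | cons a l ih =>
    rw [List.map_cons, List.sum_cons, ← ih]
    change @Bool.rec (fun _ => ℕ) 0 1 (p a) + countCode p l = _
    cases p a <;> rfl

theorem allCode_iff (p : ℕ → Bool) (l : List ℕ) :
    allCode p l = true ↔ ∀ a ∈ l, p a = true := by
  induction l with
  | nil => simp [allCode, listFold]
  | cons a l ih =>
    rw [List.forall_mem_cons, ← ih, ← Bool.and_eq_true]
    rfl

theorem ascending_cons (f : ℕ → ℕ) (hi a : ℕ) (l : List ℕ) (lo : ℕ) :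
    ascending f hi (a :: l) lo = true ↔ lo ≤ f a ∧ ascending f hi l (f a + 1) = true := by
  change and (Nat.ble lo (f a)) (ascending f hi l (f a + 1)) = true ↔ _
  rw [Bool.and_eq_true, Nat.ble_eq]

/-- Blocks can be checked separately: the upper limit of one is the lower limit of the next. -/
theorem ascending_append {f : ℕ → ℕ} {mid hi : ℕ} {l l' : List ℕ}
    (h' : ascending f hi l' mid = true) {lo : ℕ} (h : ascending f mid l lo = true) :
    ascending f hi (l ++ l') lo = true := by
  induction l generalizing lo with
  | nil =>
    have hle : lo ≤ mid := Nat.le_of_ble_eq_true h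
    cases l' with
    | nil => exact Nat.ble_eq_true_of_le (hle.trans (Nat.le_of_ble_eq_true h'))
    | cons a l' =>
      rw [ascending_cons] at h'
      exact (ascending_cons _ _ _ _ _).2 ⟨hle.trans h'.1, h'.2⟩
  | cons a l ih =>
    rw [ascending_cons] at h
    exact (ascending_cons _ _ _ _ _).2 ⟨h.1, ih h.2⟩

theorem pairwise_of_ascending {f : ℕ → ℕ} {hi : ℕ} {l : List ℕ} {lo : ℕ}
    (h : ascending f hi l lo = true) :
    (∀ a ∈ l, lo ≤ f a) ∧ l.Pairwise fun a b => f a < f b := by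
  induction l generalizing lo with
  | nil => simp
  | cons a l ih =>
    rw [ascending_cons] at h
    obtain ⟨h1, h2⟩ := ih h.2
    refine ⟨fun b hb => ?_, List.pairwise_cons.2 ⟨fun b hb => h1 b hb, h2⟩⟩
    rcases List.mem_cons.1 hb with rfl | hb
    · exact h.1
    · exact h.1.trans ((Nat.le_succ _).trans (h1 b hb))

/-- The invariant of the matrix numbered `a`. -/
noncomputable def invariantOf (a : ℕ) : ℕ := invariantCode (masks (pointCodes a))

/-- The bound for the stabilizer of the matrix numbered `a`. -/
noncomputable def boundOf (a : ℕ) : ℕ :=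
  (fun ms => boundCode (chosenLanes a ms) ms) (masks (pointCodes a))

/-- The lower bound for the size of the orbit of the matrix numbered `a`. -/
noncomputable def orbitBound (a : ℕ) : ℕ := Nat.div 475566474240 (boundOf a)

/-- The test for the minimum weight to be at least `3`. -/
noncomputable def isHeavy (a : ℕ) : Bool := heavyCode a 3

/-- The test for the minimum weight to be `d`. -/
noncomputable def hasMinWeight (d a : ℕ) : Bool :=
  and (heavyCode a d) (not (heavyCode a (Nat.succ d)))

/-- The computed data of a list of matrices. -/
def Certified (lo hi mass n₃ n₄ : ℕ) (l : List ℕ) : Prop :=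
  ascending invariantOf hi l lo = true ∧ allCode isHeavy l = true ∧ sumCode orbitBound l = mass ∧
    countCode (hasMinWeight 3) l = n₃ ∧ countCode (hasMinWeight 4) l = n₄

noncomputable instance (lo hi mass n₃ n₄ : ℕ) (l : List ℕ) :
    Decidable (Certified lo hi mass n₃ n₄ l) :=
  inferInstanceAs (Decidable (_ ∧ _))

theorem Certified.append {lo mid hi m m' n₃ n₃' n₄ n₄' : ℕ} {l l' : List ℕ}
    (h : Certified lo mid m n₃ n₄ l) (h' : Certified mid hi m' n₃' n₄' l') :
    Certified lo hi (m + m') (n₃ + n₃') (n₄ + n₄') (l ++ l') := by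
  obtain ⟨h1, h2, h3, h4, h5⟩ := h
  obtain ⟨h1', h2', h3', h4', h5'⟩ := h'
  rw [allCode_iff] at h2 h2'
  rw [sumCode_eq] at h3 h3'
  rw [countCode_eq] at h4 h4' h5 h5'
  refine ⟨ascending_append h1' h1, (allCode_iff _ _).2 fun a ha => ?_, ?_, ?_, ?_⟩
  · exact (List.mem_append.1 ha).elim (h2 a) (h2' a)
  · rw [sumCode_eq, List.map_append, List.sum_append, h3, h3']
  · rw [countCode_eq, List.map_append, List.sum_append, h4, h4']
  · rw [countCode_eq, List.map_append, List.sum_append, h5, h5']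

/-! ### The number of classes -/

theorem hammingNorm_signedPerm (σ : Equiv.Perm (Fin 10)) (ε : Fin 10 → ℤˣ) (c : Fin 10 → ZMod 3) :
    hammingNorm (signedPerm σ ε c) = hammingNorm c := by
  have h : ∀ i, signedPerm σ ε c i ≠ 0 ↔ c (σ i) ≠ 0 := fun i => by
    change ((ε i : ℤ) : ZMod 3) * c (σ i) ≠ 0 ↔ _
    rcases Int.units_eq_one_or (ε i) with h | h <;> simp [h]
  simp only [hammingNorm, h]
  exact Finset.card_bijective σ σ.bijective (by simp)

theorem MinWeightGe.of_equivalent {C D : Submodule (ZMod 3) (Fin 10 → ZMod 3)} {t : ℕ}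
    (h : MinWeightGe C t) (hCD : Equivalent C D) : MinWeightGe D t := by
  obtain ⟨σ, ε, rfl⟩ := hCD
  rintro _ ⟨c, hc, rfl⟩ h0
  rw [hammingNorm_signedPerm]
  exact h c hc fun h' => h0 (by rw [h', map_zero])

theorem isMinWeight_congr {C D : Submodule (ZMod 3) (Fin 10 → ZMod 3)} {d : ℕ}
    (hCD : Equivalent C D) : IsMinWeight C d ↔ IsMinWeight D d := by
  have h : ∀ t, MinWeightGe C t ↔ MinWeightGe D t := fun t =>
    ⟨fun h => h.of_equivalent hCD, fun h => h.of_equivalent hCD.symm⟩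
  rw [isMinWeight_iff, isMinWeight_iff, h, h]

/-- The configuration of points of the matrix numbered `a`. -/
def pointSet (a : ℕ) : Finset V5 := signedRange (systematic a)

theorem isProjective_systematic {a : ℕ} (h : heavyCode a 3 = true) :
    IsProjective (systematic a) :=
  isProjective_of_minWeightGe ((heavyCode_iff (by norm_num) (by norm_num)).1 h)

/-- Minimum weight at least 3 makes the 20 listed vectors distinct, so sums along the list are sums
over the point set. -/
theorem invariantOf_eq {a : ℕ} (h : heavyCode a 3 = true) :
    invariantOf a = invariant (pointSet a) := by
  rw [invariantOf, masks_eq, invariantCode_eq (nodup_pointVectors (isProjective_systematic h))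
    (length_pointVectors a).le, toFinset_signedVectors, pointSet]

theorem boundOf_eq {a : ℕ} (h : heavyCode a 3 = true) :
    boundOf a = stabilizerBound (pointSet a) (usesFineColours a) := by
  simp only [boundOf]
  rw [chosenLanes_eq, masks_eq, boundCode_eq (nodup_pointVectors (isProjective_systematic h))
    (length_pointVectors a).le, toFinset_signedVectors, pointSet]

theorem single_mem_pointSet (a : ℕ) (k : Fin 5) : Pi.single k 1 ∈ pointSet a :=
  mem_signedRange.2 ⟨Fin.castAdd 5 k, .inl (Fin.append_left std (col a) k).symm⟩

theorem isMinWeight_systematic_iff {a d : ℕ} (hd : 0 < d) (hd' : d < 20) :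
    IsMinWeight (toCode (systematic a)) d ↔ hasMinWeight d a = true := by
  rw [isMinWeight_iff, hasMinWeight, Bool.and_eq_true, Bool.not_eq_true', ← Bool.not_eq_true,
    heavyCode_iff hd'.le hd, heavyCode_iff hd' (Nat.succ_pos d)]

theorem Certified.heavy {lo hi m n₃ n₄ : ℕ} {l : List ℕ} (hl : Certified lo hi m n₃ n₄ l)
    (i : Fin l.length) : heavyCode l[i] 3 = true :=
  (allCode_iff _ _).1 hl.2.1 _ (List.getElem_mem _)

theorem Certified.eq_of_invariant_eq {lo hi m n₃ n₄ : ℕ} {l : List ℕ}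
    (hl : Certified lo hi m n₃ n₄ l) {i j : Fin l.length}
    (hij : invariant (pointSet l[i]) = invariant (pointSet l[j])) : i = j := by
  rw [← invariantOf_eq (hl.heavy i), ← invariantOf_eq (hl.heavy j)] at hij
  have h4 := List.pairwise_iff_getElem.1 (pairwise_of_ascending hl.1).2
  by_contra hne
  rcases lt_or_gt_of_ne (fun h => hne (Fin.ext h)) with h5 | h5
  · exact absurd hij (h4 i j i.2 j.2 h5).ne
  · exact absurd hij.symm (h4 j i j.2 i.2 h5).ne

/-- Completeness of the list: the columns of a parity check matrix of `C` form a configuration,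
which lies in the orbit of a listed one because the total mass is exhausted. -/
theorem Certified.exists_equivalent {lo hi n₃ n₄ : ℕ} {l : List ℕ}
    (hl : Certified lo hi 126422205423228 n₃ n₄ l) {C : Submodule (ZMod 3) (Fin 10 → ZMod 3)}
    (hC : Module.finrank (ZMod 3) C = 5) (hw : MinWeightGe C 3) :
    ∃ i : Fin l.length, Equivalent (toCode (systematic l[i])) C := by
  obtain ⟨x, hx, rfl⟩ := exists_toCode_eq hC
  have hp := isProjective_of_minWeightGe hw
  have hmass : ∑ i : Fin l.length,
      475566474240 / stabilizerBound (pointSet l[i]) (usesFineColours l[i]) = 126422205423228 := by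
    have h3 := hl.2.2.1
    rw [sumCode_eq, ← Fin.sum_univ_fun_getElem] at h3
    rw [← h3]
    refine Finset.sum_congr rfl fun i _ => ?_
    rw [orbitBound, nat_div_eq]
    exact congrArg _ (boundOf_eq (hl.heavy i)).symm
  obtain ⟨i, g, hg⟩ := exists_smul_eq (fun i : Fin l.length => pointSet l[i])
    (fun i => usesFineColours l[i])
    (fun i => signedRange_mem_configurations rfl (isProjective_systematic (hl.heavy i))
      (rangeSpan_systematic _))
    (fun i k => single_mem_pointSet _ k) (fun i j hij => hl.eq_of_invariant_eq hij) hmass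
    (signedRange_mem_configurations rfl hp hx)
  exact ⟨i, equivalent_of_smul_eq hp hg⟩

theorem Certified.eq_of_equivalent {lo hi m n₃ n₄ : ℕ} {l : List ℕ} (hl : Certified lo hi m n₃ n₄ l)
    {i j : Fin l.length}
    (h : Equivalent (toCode (systematic l[i])) (toCode (systematic l[j]))) : i = j := by
  obtain ⟨g, hg⟩ := exists_smul_eq_of_equivalent (rangeSpan_systematic _)
    (rangeSpan_systematic _) h
  refine hl.eq_of_invariant_eq ?_
  rw [pointSet, pointSet, ← hg, invariant_smul]

/-- Classes correspond to the list entries of minimum weight `d`: invariants separate them, and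
completeness applies because `3 ≤ d`. -/
theorem Certified.card_codeClass {lo hi n₃ n₄ : ℕ} {l : List ℕ}
    (hl : Certified lo hi 126422205423228 n₃ n₄ l) {d : ℕ} (hd : 3 ≤ d) (hd' : d < 20) :
    Nat.card (CodeClass 10 5 d) = countCode (hasMinWeight d) l := by
  have hp : ∀ a, IsMinWeight (toCode (systematic a)) d ↔ hasMinWeight d a = true := fun a =>
    isMinWeight_systematic_iff (by omega) hd'
  let φ : {i : Fin l.length // hasMinWeight d l[i] = true} → CodeClass 10 5 d := fun i =>
    Quotient.mk (codeSetoid 10 5 d) ⟨toCode (systematic l[i.1]),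
      finrank_toCode (rangeSpan_systematic _), (hp _).2 i.2⟩
  have hφ : Function.Bijective φ := by
    constructor
    · intro i j hij
      exact Subtype.ext (hl.eq_of_equivalent (Quotient.exact hij))
    · intro q
      induction q using Quotient.inductionOn with
      | h C =>
        obtain ⟨C, hC, hw⟩ := C
        obtain ⟨i, hi⟩ := hl.exists_equivalent hC ((isMinWeight_iff.1 hw).1.mono hd)
        exact ⟨⟨i, (hp _).1 ((isMinWeight_congr hi).2 hw)⟩, Quotient.sound hi⟩
  rw [← Nat.card_eq_of_bijective φ hφ, Nat.card_eq_fintype_card, Fintype.card_subtype,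
    Finset.card_filter, countCode_eq, ← Fin.sum_univ_fun_getElem]
  rfl

/-! ### The representatives -/

/-- The 25 base-3 digits of an entry form a `5 × 5` matrix `A`, column by column; `[I | A]` is the
parity check matrix. Entries are ordered by invariant, not by size. -/
def representatives₁ : List ℕ :=
  [559713209746, 418572557806, 285974019301, 398728053016, 366845124271, 352890130963,
   158115457003, 122512859968, 296434372504, 482961024301, 17635517725, 41999842498,
   186436196275, 36532974307, 14537635150, 528140877034, 113420574688, 172062594607,
   397694976889, 43020177628, 146675184439, 157050914098, 370895942533, 286665425248,
   141022949998, 353461475695, 125941013824, 440657206510, 421974431968, 174944125552,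
   139660184371, 14148692779, 175607010832, 53638406725, 296620908295, 556121245684,
   183182997532, 176009087659, 318519192028, 285992987422, 408160054012, 111778656007,
   472267468093, 120102243592, 328405707049, 384742637788, 444143990911, 450039789625,
   322335738850, 42047691907, 387095845144, 311545720192, 404697230113, 411890769832,
   307598130787, 35328033805, 291230810869, 381284551201, 450255377524, 293554861411,
   427124823529, 290581901689, 167873257390, 301415032444, 376821496291, 531327831745,
   457993808023, 153849580096, 486385557664, 97788392914, 439411429831, 500075912299,
   318593631685, 158757331819, 324804013294, 468723550504, 298041804382, 38417241289,
   109315367923, 292963409131, 394212916408, 326108279866, 367449002815, 50039501665,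
   60485492569, 311545661143, 132560583871, 422408518663, 49246048066, 165333618949,
   317900691670, 101592153562, 287193689545, 36190215994, 318058483990, 464173391785,
   126090814810, 425876395198, 344885015365, 18888674107, 165505687735, 342155081812,
   155016754816, 367449061864, 105268503757, 465039121360, 397653151693, 164023152232,
   390764454808, 298099200010, 343087215934, 439823532802, 303413032912, 38589605320,
   137206500142, 19070545027, 292966484989, 50111232808, 289465881916]

theorem certified_representatives₁ :
    Certified 0 449426149116 5250496062240 106 13 representatives₁ := by
  decide +kernel

def representatives₂ : List ℕ :=
  [315074088481, 172488868132, 467394408823, 423237553231, 57616256002, 321509071354,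
   399345042145, 331969424557, 318679725127, 156981905536, 338291606344, 336401170105,
   35471155189, 17909327938, 36204543769, 425818763374, 127075812394, 385273547347, 167917878715,
   163952386294, 160468748986, 464924330104, 158173088827, 97831518403, 406294696102,
   137797475926, 101193886561, 39034539535, 50269143226, 301585984411, 328231904710,
   465124669969, 36092364061, 136536819106, 129069075550, 526669743640, 408442473193,
   446381922775, 99457668814, 433041176848, 17995721737, 322597049179, 175833660820,
   293540453455, 98294875906, 36590369935, 36537711619, 509520733060, 286090780306, 371067657025,
   45803603146, 41918008117, 328233139627, 300338864419, 489701390098, 151314073879,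
   301200061279, 136573159839, 50642687200, 447532923379, 514427515627, 298204379671,
   300453956032, 36466085182, 437058207877, 57084801610, 377895087292, 423470324389,
   161659873228, 436280822680, 112309862998, 57532229275, 130347363190, 412120470442,
   122717365159, 318933812974, 331924429219, 350400966025, 367925246392, 514108880905,
   313999404421, 47554432240, 162162392404, 59467265005, 155088381253, 377252626432,
   423111070273, 428932534036, 101305555960, 130647645859, 427196270632, 312194563996,
   17635477180, 384771335602, 102944453215, 449996742904, 348870370288, 409163932669,
   383795065093, 371235578989, 143389226893, 132686235031, 401455612048, 36611522869,
   294068686090, 317527620088, 348755106640, 287467894840, 285978933760, 39808790023,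
   174872284051, 113045611351, 293569800808, 338383385986, 15172189096, 36135634792,
   158541730528, 338649153349, 18195381985, 404525043229]

theorem certified_representatives₂ :
    Certified 449426149116 472067632236 9804829407516 106 14 representatives₂ := by
  decide +kernel

def representatives₃ : List ℕ :=
  [165888510142, 38543056204, 43649986522, 429109458232, 49045221211, 377176026487, 38887692412,
   328482640156, 470904702466, 60743845336, 405431711628, 329983968721, 60911767300,
   290627625334, 162262291126, 559555371769, 394251239209, 157393996321, 40024496020,
   430256825959, 167442246553, 179462436934, 35501873818, 335956353988, 449868707176,
   420050751142, 373274739238, 53062869514, 150407135176, 308719695307, 401215183024,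
   18756293989, 43065932863, 108296595526, 409407936529, 36336354529, 315279106609, 151744613530,
   412043870497, 415402749652, 296606913682, 101361349525, 123850338322, 388329319705,
   385000445722, 318022286953, 111783379927, 290613263035, 360475396096, 126734396188,
   46506962029, 286146560479, 147006824755, 39579679903, 181801487128, 157585209169,
   324472504468, 419779466644, 415561373527, 314286002023, 436054329220, 411684793528,
   122281688245, 169178535535, 326012016604, 411915965251, 364262010187, 328290797695,
   99352489153, 420241833706, 14139067792, 325452954064, 380122276342, 420083995729, 19156447930,
   479325895420, 306899803921, 60639138067, 161846244058, 99266395711, 384842535304, 61088219104,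
   335205473512, 398875766350, 334937581591, 336282876454, 451431810751, 411514078765,
   321464076016, 416798096026, 392328426622, 161731452802, 98926214422, 326497184320,
   305163127174, 328936498510, 385359168397, 52546367911, 307561933750, 144594592924,
   315020753842, 404658920704, 327923032783, 376802954905, 544141405696, 120294348493,
   456934055620, 324430679272, 150498305617, 106347210889, 289479700588, 186139416001,
   350348307709, 14454743746, 43712165119, 409891733698, 137707117564, 14672044066, 426609605425,
   422580823645]

theorem certified_representatives₃ :
    Certified 472067632236 486094950828 10602196780032 105 15 representatives₃ := by
  decide +kernel

def representatives₄ : List ℕ :=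
  [524654092633, 289591913614, 481856158462, 19277395861, 324918922648, 14597701375, 50151584407,
   297056585209, 39079534873, 312046337614, 287252923675, 126176908252, 433568728354,
   134148899452, 460490517841, 129471212632, 186024624745, 297974915257, 36204446803,
   479183903707, 45759263665, 170925955096, 141107808523, 102839273554, 510706955029,
   39952869583, 43163784796, 40167512698, 520867478542, 150097028332, 39849069181, 102570909241,
   388355440495, 314299294366, 317757570286, 401145505204, 101323026724, 413253443605,
   373251229996, 527229351013, 160593637621, 315623480377, 414985396432, 50082772396,
   99266586250, 286550350690, 183183541159, 422551476292, 320990443987, 102313101307,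
   158227670029, 291125631208, 287638846807, 380251429897, 301499890969, 46650569197,
   296967171631, 290128011745, 367748794588, 359345072398, 176061745975, 318507538243,
   49449011422, 443281751860, 49348045615, 39650879605, 426112603384, 381322992100, 319110264778,
   286117876057, 332005621594, 460447471120, 50269733716, 287552753365, 144556401613,
   162061950055, 385373989696, 158359459657, 496845910867, 120402290065, 48877594492,
   104761961716, 398789672908, 350314872583, 353801656984, 296549518054, 287252661235,
   320860772383, 18024419551, 286405019158, 104753990101, 174528028381, 17682702988,
   116700317716, 369834123415, 328217923489, 493359126466, 126158268244, 334923232684,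
   179677624882, 42042967987, 304986675370, 465210835852, 104768831119, 331302570808,
   349345458823, 402362550751, 405692160106, 60729496429, 185005675201, 444085111318,
   286104748675, 46664800006, 380289739306, 319038447802, 381396199468, 345394694839,
   36089752513, 49576085113, 398173332838]

theorem certified_representatives₄ :
    Certified 486094950828 496995764084 12922858428480 106 14 representatives₄ := by
  decide +kernel

def representatives₅ : List ℕ :=
  [49564085980, 98090153023, 157149899941, 292966556224, 153980313376, 35040687979, 332450483368,
   185005852348, 300294524938, 324995855755, 56277248692, 322454032501, 307025835619,
   140793748024, 359617701631, 507220170628, 461437545703, 50180320138, 300425258218,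
   322511428129, 320860760197, 130232931340, 471395805259, 374683362307, 297584136715,
   136149398617, 406279874803, 36504276493, 528387112570, 118752224809, 287384831401,
   391859223268, 59351942308, 160598361541, 125597757883, 339854519380, 398718473206,
   53526286066, 158129818096, 39115731910, 155054946127, 381255853387, 105799885708,
   402205257607, 146905134637, 43693033243, 325032052792, 186436005736, 119058275776,
   54114650302, 447533572918, 106474284337, 129658996192, 450001466824, 300352156762,
   430156928443, 388415413147, 133707964990, 185044175149, 315305036860, 57458418025,
   130647455320, 451020239221, 334804821943, 99084124840, 126846610420, 321962961298,
   160944309913, 116934637540, 433086172186, 42030221143, 422565884248, 136173399970,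
   339554689690, 40182333997, 113320779691, 137306963623, 476054298967, 17640201100, 52997482552,
   544500246469, 129556938388, 176565455077, 481365055669, 408604338688, 315447028573,
   286677424381, 52723278715, 167772815041, 155162192503, 156981893350, 356204236369,
   470890353559, 126172211791, 35400908011, 116288936725, 118739477965, 105828583522,
   479541496711, 42566319274, 162204966733, 374898815194, 133000676068, 404632289605,
   47071876072, 123374153794, 42033343000, 18655830508, 41991870883, 500332695268, 132971978254,
   162028514929, 158373808564, 300466769665, 182949221335, 514051747717, 43511280421,
   132700846378, 287744026468, 55990146136]

theorem certified_representatives₅ :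
    Certified 496995764084 508036122030 11211741081684 111 9 representatives₅ := by
  decide +kernel

def representatives₆ : List ℕ :=
  [130733548762, 541102677367, 326083833580, 357146449672, 440014745650, 60902155705,
   503648527702, 380261054884, 119230580758, 143465766583, 531627661435, 475925204461,
   341893679629, 304111346386, 123781132894, 339769660855, 408461381059, 320857684339,
   412074589126, 548075714728, 101346987226, 172522303258, 133030871239, 383776523707,
   402793090402, 43669118398, 175975652533, 18799260529, 521167308232, 346574000335,
   413038800490, 346828088182, 306366016455, 122202753124, 297672925279, 109903200718,
   341870170387, 551114974498, 331433326426, 394208192488, 541147298692, 369764445595,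
   404673269611, 498775468432, 317470224460, 132973213171, 53971633624, 551100743689,
   425933612473, 50558660473, 161728685239, 184991503441, 479426589544, 140033175772,
   293096168779, 472528778422, 43223757448, 503733386227, 304901816845, 50537507539,
   183121362562, 420227012407, 411943428148, 350017810456, 294526322167, 160636684342,
   429039780412, 34925542429, 42349018954, 305072768812, 370964485030, 324347544598, 41985698197,
   182807229622, 408429180850, 381441844345, 171041243980, 112773454510, 318633983284,
   296807740537, 101365528612, 376778994403, 118715968723, 39533424817, 479502347224,
   423240282877, 134310691525, 285974373595, 153892684660, 18658973497, 35074123105,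
   380265778804, 495288684031, 297586831837, 35098083607, 165060871618, 185048721922,
   357106170514, 475839111019, 57125153209, 102380240020, 430170732517, 290785449919,
   376630768021, 311620607716, 317786078767, 416137501471, 43063262266, 14407327399, 48980280703,
   416309688355, 290628156775, 315480463699, 311960244172, 405763241710, 380820603208,
   307011486712, 19246806292, 463907624422, 35059774198]

theorem certified_representatives₆ :
    Certified 508036122030 517425114710 15036074384760 114 6 representatives₆ := by
  decide +kernel

def representatives₇ : List ℕ :=
  [429104720920, 39677000395, 50137353598, 314334066694, 321994322644, 127337122723,
   151568161726, 36695549596, 101318302804, 325567200487, 105940231789, 55862069863, 60500386309,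
   186254325355, 380304101605, 308473459771, 425552996011, 355840817233, 19660157032,
   311706156325, 380261095429, 116446229869, 315018090310, 102844010866, 130393367473,
   99012307864, 331993622461, 120363553921, 314002526278, 287729205169, 134368559545,
   97821893416, 151802481550, 387712979635, 144680686366, 17664161602, 15760021891, 381528010228,
   120273195559, 296582953180, 408145705105, 401172136303, 411646838413, 488338624471,
   377048121241, 130637843725, 43077310816, 304030154011, 127160861458, 104809811125,
   293493200863, 39691231204, 338720955727, 328967891446, 55980480604, 186526836490,
   446859430291, 439397447404, 102753180112, 97692739861, 563115967420, 415577907490,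
   343341303781, 317374047031, 153893919577, 366562572619, 291072972892, 314989392496,
   290739745993, 42301602607, 324921513064, 402316808908, 134049381196, 412650717070,
   300112239469, 289465350475, 287787073189, 423283257157, 15690816463, 185249783767,
   460444382068, 286347387334, 151483303201, 457493662993, 432526564813, 349439900080,
   318476176897, 39564786163, 390685152001, 102929631916, 125998409452, 143683066903,
   353501827294, 322420597375, 34930620643, 35592750472, 321545268391, 162114608371, 39693998767,
   334905643822, 408202555900, 380308280692, 60552703480, 129504280072, 446553005224,
   151759434829, 321032945875, 464235582568, 290037135091, 329570617981, 98893455619,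
   177888794476, 328188800146, 454604344114, 314059377073, 158718182332, 143432331457,
   324773818123, 164123468743, 146604674821]

theorem certified_representatives₇ :
    Certified 517425114710 528795370982 12340991288340 117 3 representatives₇ := by
  decide +kernel

def representatives₈ : List ℕ :=
  [35102820919, 320987204032, 158168790436, 289863295078, 45534476308, 161616602497, 98309874352,
   127160670919, 443023174102, 52732832467, 294358400203, 332454675847, 367834888030,
   318534347695, 335162368948, 561879894703, 134134239721, 332880950578, 99442847515,
   398830024507, 49494892738, 298013106568, 317355078910, 380534905642, 129518628979,
   108334918327, 364348103629, 416223594913, 544127174887, 39579148462, 383752563205,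
   287184111664, 427200581209, 123233807713, 50627865901, 297713276878, 134220333163,
   118756948729, 105005958511, 287586188491, 419710379314, 161655574837, 371412030793,
   113048150458, 453355491577, 432836671657, 43020209218, 18113833129, 509477686339,
   307002326377, 388501579030, 56219616868, 300511431841, 143374935829, 409623642526,
   39809380513, 408427945933, 381872383996, 510622096504, 322008684943, 139533621232,
   15157295356, 43477845295, 449871783034, 168688023232, 113389985119, 374422533700, 56350430329,
   384868656094, 42393640279, 411929257594, 298089043582, 342465974797, 126906583072,
   176109530008, 129690933961, 412822903954, 169193356834, 322506690817, 129645052645,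
   290051078638, 294671832295, 412909069837, 102611188399, 287659999741, 313887191395,
   496617825712, 315362170048, 530156528041, 426597854674, 429034211302, 143123459530,
   53938389037, 310489110778, 53667104539, 101179524262, 510707145568, 383781261019,
   325907572315, 106326057955, 394241614222, 140681533792, 143592190249, 387198367600,
   363350484166, 394466827108, 465369146221, 137635683853, 179548530376, 185259763048,
   299921511199, 422361102316, 377836207699, 451117559713, 144766734151, 440513630932,
   42316818745, 101289591598, 129499721113, 376774270483]

theorem certified_representatives₈ :
    Certified 528795370982 539948335696 11812377685680 111 9 representatives₈ := by
  decide +kernel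

def representatives₉ : List ℕ :=
  [359863699765, 453473902318, 383747839285, 297742012609, 106431237616, 99281055442,
   120378375220, 52508045110, 465081695689, 18644079757, 409135779688, 116807564092,
   547613959288, 331675584547, 116791148470, 45962227021, 286122599977, 482812679821,
   293078698015, 38428147858, 398830062424, 125712666229, 345758232073, 147996518800,
   324746355226, 137994234934, 35518407781, 517680523831, 321244354687, 178505915575,
   294114941176, 203689815721, 34944510550, 339600431533, 19070354488, 401741309614, 46879771171,
   329309307652, 97818771559, 109544478043, 36092895502, 457517860897, 54110339725, 548073124312,
   332440871773, 171414315562, 335191492291, 161846834548, 324347615833, 287252961592,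
   105943374778, 175661592034, 472438420060, 165515299330, 46553366803, 14177377201, 57601434703,
   322047657283, 97860202825, 175032818356, 395302888507, 43563938737, 421973314141,
   186063065644, 324816864844, 383790886006, 338942993359, 551591846482, 517595665306,
   294441463642, 137621024122, 544586339911, 320949463981, 342915029050, 418620407215,
   444029081557, 310558788598, 53483770786, 339443138389, 439785045040, 132957997033,
   122216609920, 122487664549, 40098307270, 35547755134, 475754252494, 366277661194,
   363158641705, 381513661321, 42489386167, 43654297099, 300093698083, 378067156078,
   399306306001, 102571499731, 465024772453, 184876712185, 370795500184, 451134558085,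
   136664502763, 49462954969, 318560872882, 53638368808, 408113504896, 465612534013,
   593162349544, 349900251637, 134167674847, 339940612822, 325553396413, 370935749299,
   17894111800, 108770227555, 360435589330, 172189038442, 148272650428, 429334671118,
   408027294364, 290699356477, 43478035834]

theorem certified_representatives₉ :
    Certified 539948335696 551147424934 11629086440400 105 15 representatives₉ := by
  decide +kernel

def representatives₁₀ : List ℕ :=
  [291039537766, 360966498889, 98826316906, 101796658753, 318768430117, 419064691891,
   57632024272, 411873331873, 325496000785, 113031852934, 181478087941, 321259570825,
   15774843190, 53938198498, 36680728297, 384828731230, 394069413946, 48877758247, 406275564226,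
   381355750903, 461537988052, 296450193532, 120021719260, 15583570087, 112338204331,
   465196486945, 38830034344, 317800249321, 116891590819, 50078474005, 42431910358, 160468689937,
   148081377325, 130823907124, 430211181082, 165548734456, 461695826029, 366678938479,
   35033143099, 150582293014, 53526817507, 458105456290, 492316511665, 161617133938,
   161714454430, 99084715330, 325822523251, 47141081500, 151227980437, 454664316766, 46782358825,
   419596132891, 419592892936, 112840593223, 15790611460, 331924311121, 112802152324,
   42374476813, 411613403287, 367337413597, 296850845101, 439842440668, 34941363457,
   355728675442, 106416416317, 286596232006, 419796472756, 412662467821, 434073635221,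
   338276139610, 391842224896, 415417098559, 472352326618, 299926235119, 404942396449,
   397699700809, 122267693632, 311660414482, 332967044020, 294612415609, 418487647567,
   55953849505, 125581936855, 444098987590, 357464893189, 405849335152, 60000241279,
   109833995290, 381356295736, 313884115537, 322654917199, 287179813273, 14112436693,
   59955245941, 174885135601, 35112445906, 167825841043, 321418194700, 125713046767,
   447002001634, 360478163659, 307297217083, 695854418245, 562052199685, 120187102117,
   36078001762, 129706739374, 160852272241, 324823176760, 158775506725, 15171657655,
   355714785535, 395231688805, 401181761290, 349245016474, 433011829495, 384728288881,
   102412998823, 313887262630, 317486188822]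

theorem certified_representatives₁₀ :
    Certified 551147424934 566615651708 11013161805360 106 14 representatives₁₀ := by
  decide +kernel

def representatives₁₁ : List ℕ :=
  [185995926931, 36322005622, 18816266641, 158556390259, 374722363390, 125683968415,
   436279116577, 429420396874, 15169046107, 53026672477, 490001436571, 60926427031, 160880780722,
   129614334016, 363850629196, 116876769520, 336367734979, 364438461991, 102453350422,
   444089409709, 129183866806, 314377172464, 17864988457, 300052266817, 42006711901, 98105369161,
   447776913847, 394171936402, 296438919277, 360775225786, 281474177092, 538687323679,
   324477228388, 122239009210, 137536165597, 60499913917, 415176124702, 432854522959,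
   439408353973, 349201910704, 356948260096, 356830773718, 338706785173, 43206751336,
   312151517275, 384006473905, 439795024321, 161674529566, 104768339008, 313999023883,
   134325512824, 391716206590, 430683055033, 181515827992, 324837525667, 35112078220,
   388684160725, 15799171378, 324702015745, 322410985780, 325449745699, 39618120802,
   325907381776, 15243388798, 384809776501, 106239964513, 99098473747, 43392986770, 376817317204,
   325993475218, 384021690043, 113385674542, 486299464222, 418602555913, 38417405044,
   317931410299, 397968827647, 118785646543, 42029840605, 370324052968, 146633753173,
   18658442056, 423598933111, 38431235902, 18888083617, 52467065104, 411498257737, 422331978973,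
   160627059355, 335955881596, 160454695324, 46552717264, 324462879481, 108282246619,
   433583174227, 151654255168, 322123535248, 491801899630, 178014812782, 143608724212,
   113404806418, 405070301695, 161860592965, 430601744560, 113228193046, 409781480503,
   98969333584, 342429777760, 388841642221, 429066411511, 49539888076, 318046484857,
   286081619971, 15583760626, 345743883166, 322080416086, 34944439315, 113299626757, 19215864616,
   329394166177]

theorem certified_representatives₁₁ :
    Certified 566615651708 592571799094 10657147458672 105 15 representatives₁₁ := by
  decide +kernel

def representatives₁₂ : List ℕ :=
  [104795462218, 312136695976, 57013070467, 56549653915, 489776637028, 115229184322,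
   645331039948, 129073268029, 183487217980, 313970326069, 463934255521, 303539051218,
   524861134006, 528169574848, 510922556320, 296793449473, 41904189445, 500480921650,
   450973984135, 123673886518, 19261627591, 304574821987, 440598326917, 113213533315,
   19003333873, 305187573460, 129241262434, 14508937336, 14182114513, 42272479264, 19177600864,
   19032163177, 18183026371, 411670798915, 101720058808, 136047368272, 129068721256,
   436355656267, 185020201255, 39736973047, 444158221720, 113428721263, 14023804144, 14581167412,
   371053308118, 313873208968, 401228987098, 362790876793, 289651886266, 322009216384,
   126174802207, 127306181047, 164029324918, 17966986006, 46796707732, 36322596112, 446384998633,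
   18081895360, 60499854868, 416149252222, 385017333736, 454618574923, 301159709680, 18067951813,
   14119981573, 14020657051, 164043673825, 305220451567, 52375285462, 408016020109, 324861446839,
   181743855304, 186282905071, 168544447654, 297586833043, 52503321190, 433959506896,
   46089300712, 378385599595, 319019906416, 118739097427, 160468677751, 298246882765,
   370360606486, 123759979960, 408011473336, 42086014708, 322249907848, 370781151277,
   314362823557, 186253734865, 40225380718, 129084542284, 50022475834, 366873822085, 14191739500,
   59352001357, 119010859429, 387191498197, 156981964585, 59337947695, 36131336401, 357063596185,
   419868289732, 17922620281, 143446858717, 290164208782, 402376899658, 296434726798,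
   186268083772, 139902442492, 296439450718, 167932227622, 331474757692, 421958610940,
   185001128428, 464231023609, 112257011956, 301746126505, 541131493279]

theorem certified_representatives₁₂ :
    Certified 592571799094 777210471695 4141244600064 111 8 representatives₁₂ := by
  decide +kernel

/-- Matrices for all the codes of minimum weight at least `3`. -/
def representatives : List ℕ :=
  representatives₁ ++ (representatives₂ ++ (representatives₃ ++ (representatives₄ ++
    (representatives₅ ++ (representatives₆ ++ (representatives₇ ++ (representatives₈ ++
    (representatives₉ ++ (representatives₁₀ ++ (representatives₁₁ ++ representatives₁₂))))))))))

/-- The masses of the twelve blocks add up to the bound for all configurations, which is what makes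
the list complete. -/
theorem certified_representatives :
    Certified 0 777210471695 126422205423228 1303 135 representatives :=
  certified_representatives₁.append (certified_representatives₂.append
    (certified_representatives₃.append (certified_representatives₄.append
    (certified_representatives₅.append (certified_representatives₆.append
    (certified_representatives₇.append (certified_representatives₈.append
    (certified_representatives₉.append (certified_representatives₁₀.append
    (certified_representatives₁₁.append certified_representatives₁₂))))))))))

end TernaryCode

theorem mainTheorem2 :
    Nat.card (TernaryCode.CodeClass 10 5 4) = 135 ∧
      Nat.card (TernaryCode.CodeClass 10 5 3) = 1303 := by
  have h := TernaryCode.certified_representatives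
  exact ⟨(h.card_codeClass (by norm_num) (by norm_num)).trans h.2.2.2.2,
    (h.card_codeClass (by norm_num) (by norm_num)).trans h.2.2.2.1⟩
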